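/- Let $\mathcal X$ be a finite set and let $W=(W(x|x'))_{x,x'\in\mathcal X}$ be an ergodic transition matrix: $W(x|x')\ge 0$, $\sum_x W(x|x')=1$ for all $x'$, $W$ is irreducible, and there are no state $x$ and integer $m\ge 2$ such that $W^n(x|x)=0$ for every $n$ not divisible by $m$. Let $g_1,\dots,g_d:\mathcal X\times\mathcal X\to\mathbb R$ be linearly independent under $W$, i.e. no non-trivial linear combination of the $g_j$ has the form $f(x)-f(x')+c$ (with $f:\mathcal X\to\mathbb R$ and a constant $c$) for all $(x,x')$ with $W(x|x')>0$. For $\vec\theta\in\mathbb R^d$ put $\overline W_{\vec\theta}(x|x')=W(x|x')e^{\sum_j\theta^jg_j(x,x')}$, let $\lambda_{\vec\theta}$ be its Perron–Frobenius eigenvalue and $\overline P^3_{\vec\theta}$ the Perron–Frobenius eigenvector of its transpose, and define $$\phi(\vec\theta)=\log\lambda_{\vec\theta},\qquad W_{\vec\theta}(x|x')=\lambda_{\vec\theta}^{-1}\,\overline P^3_{\vec\theta}(x)\,\overline W_{\vec\theta}(x|x')\,\overline P^3_{\vec\theta}(x')^{-1},\qquad \eta_j(\vec\theta)=\frac{\partial\phi}{\partial\theta^j}(\vec\theta),$$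 and $\mathsf H_{\vec\theta}[\phi]=\big[\frac{\partial^2\phi}{\partial\theta^i\partial\theta^j}(\vec\theta)\big]_{i,j}$. Let $P_{\vec\theta}$ be an arbitrary family of probability distributions on $\mathcal X$ depending smoothly on $\vec\theta\in\mathbb R^d$. Let $X^{n+1}=(X_{n+1},\dots,X_1)$ be the Markov chain with initial distribution $P_{\vec\theta}$ and transition matrix $W_{\vec\theta}$, and $\vec g^n(X^{n+1})=\big[\sum_{i=1}^n g_j(X_{i+1},X_i)\big]_j$. Let $J^n_{\vec\theta}$ be the Fisher information matrix of the law of $X^{n+1}$ for the natural parameter $\vec\theta$, and $\tilde J^n_{\vec\theta}$ the one for the expectation parameter $\vec\eta$, taken at $\vec\eta(\vec\theta)$. Then $\phi$ is $C^2$, the map $\vec\theta\mapsto\vec\eta(\vec\theta)$ is injective, $\mathsf H_{\vec\theta}[\phi]$ is positive definite for every $\vec\theta$, and for every $\vec\theta\in\mathbb R^d$: 1. with $\mathsf{MSE}_{\vec\theta}[\vec T]_{i,j}=\mathsf E_{\vec\theta}[(T_i-\eta_i(\vec\theta))(T_j-\eta_j(\vec\theta))]$ and $\mathsf{Cov}_{\vec\theta}$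 the covariance matrix, $$\lim_{n\to\infty}n\,\mathsf{MSE}_{\vec\theta}\Big[\frac{\vec g^n(X^{n+1})}{n}\Big]=\lim_{n\to\infty}n\,\mathsf{Cov}_{\vec\theta}\Big[\frac{\vec g^n(X^{n+1})}{n}\Big]=\mathsf H_{\vec\theta}[\phi];$$ 2. $\displaystyle\lim_{n\to\infty}\frac{J^n_{\vec\theta}}{n}=\mathsf H_{\vec\theta}[\phi]$ and $\displaystyle\lim_{n\to\infty}\frac{\tilde J^n_{\vec\theta}}{n}=\mathsf H_{\vec\theta}[\phi]^{-1}$; 3. $\vec g^n(X^{n+1})/n$ is an asymptotically efficient estimator of the expectation parameter: $\mathsf E_{\vec\theta}[\vec g^n(X^{n+1})/n]\to\vec\eta(\vec\theta)$, the matrix $\tilde J^n_{\vec\theta}$ is invertible for all large $n$, and the Cramér–Rao bound is attained to order $1/n$, i.e. $\mathsf{MSE}_{\vec\theta}[\vec g^n(X^{n+1})/n]=(\tilde J^n_{\vec\theta})^{-1}+o(1/n)$. -/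

import Mathlib

open Filter Topology
open scoped ContDiff Matrix

noncomputable section

namespace MarkovExp

/-! ## Calculus on the parameter space and statistics on finite sample spaces -/

section General

variable {d : ℕ} {Ω : Type*} [Fintype Ω]

/-- Partial derivative of `f` at `θ` in the `i`-th coordinate. -/
def partialDeriv (f : (Fin d → ℝ) → ℝ) (i : Fin d) (θ : Fin d → ℝ) : ℝ :=
  lineDeriv ℝ f θ (Pi.single i 1)

/-- The gradient, as a vector of partial derivatives. -/
def gradVec (f : (Fin d → ℝ) → ℝ) (θ : Fin d → ℝ) : Fin d → ℝ :=
  fun i => partialDeriv f i θ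

/-- The Hesse matrix of second partial derivatives. -/
def hesse (f : (Fin d → ℝ) → ℝ) (θ : Fin d → ℝ) : Matrix (Fin d) (Fin d) ℝ :=
  Matrix.of fun i j => partialDeriv (fun θ' => partialDeriv f j θ') i θ

/-- Expectation of a real random variable under the probability mass function `p`. -/
def expect (p : Ω → ℝ) (Y : Ω → ℝ) : ℝ := ∑ z, p z * Y z

/-- Covariance matrix of a random vector under the probability mass function `p`. -/
def covMatrix (p : Ω → ℝ) (Y : Ω → Fin d → ℝ) : Matrix (Fin d) (Fin d) ℝ :=
  Matrix.of fun i j =>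
    expect p fun z =>
      (Y z i - expect p fun z' => Y z' i) * (Y z j - expect p fun z' => Y z' j)

/-- Mean square error matrix of the estimator `T` when the true value is `η`. -/
def mseMatrix (p : Ω → ℝ) (T : Ω → Fin d → ℝ) (η : Fin d → ℝ) : Matrix (Fin d) (Fin d) ℝ :=
  Matrix.of fun i j => expect p fun z => (T z i - η i) * (T z j - η j)

/-- Fisher information matrix at `θ` of a parametric family of probability mass functions: the
second moments of the score vector. Points of mass zero at `θ` do not contribute. -/
def fisherInfo (p : (Fin d → ℝ) → Ω → ℝ) (θ : Fin d → ℝ) : Matrix (Fin d) (Fin d) ℝ :=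
  Matrix.of fun i j =>
    expect (p θ) fun z =>
      partialDeriv (fun θ' => Real.log (p θ' z)) i θ *
        partialDeriv (fun θ' => Real.log (p θ' z)) j θ

/-- Fisher information matrix, at the point `η θ`, of the same family when it is parametrized by
`e = η θ` instead of `θ`. It is meant for an injective `η` with open range;
`Function.invFun η` is then the inverse map on that range. -/
def fisherInfoReparam (p : (Fin d → ℝ) → Ω → ℝ) (η : (Fin d → ℝ) → Fin d → ℝ)
    (θ : Fin d → ℝ) : Matrix (Fin d) (Fin d) ℝ :=
  fisherInfo (fun e => p (Function.invFun η e)) (η θ)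

end General

/-- The sequence of estimators `T n` of the parameter `η θ` is asymptotically efficient for the
families `p n`: it is asymptotically unbiased, and its mean square error matrix attains the
Cramér–Rao bound (the inverse Fisher information matrix for the parameter `η`) up to `o(1/n)`. -/
structure IsAsymptoticallyEfficient {d : ℕ} {Ω : ℕ → Type*} [∀ n, Fintype (Ω n)]
    (p : ∀ n, (Fin d → ℝ) → Ω n → ℝ) (T : ∀ n, Ω n → Fin d → ℝ)
    (η : (Fin d → ℝ) → Fin d → ℝ) : Prop where
  unbiased : ∀ θ i, Tendsto (fun n => expect (p n θ) fun z => T n z i) atTop (𝓝 (η θ i))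
  regular : ∀ θ, ∀ᶠ n in atTop, IsUnit (fisherInfoReparam (p n) η θ).det
  attains : ∀ θ, Tendsto
    (fun n : ℕ => (n : ℝ) • (mseMatrix (p n θ) (T n) (η θ) - (fisherInfoReparam (p n) η θ)⁻¹))
    atTop (𝓝 0)

/-! ## Transition matrices and their exponential families

The entry `W x x'` is the probability `W(x|x')` of moving from `x'` to `x`, so that transition
matrices are column-stochastic. -/

section Markov

variable {X : Type*} [Fintype X] [DecidableEq X] {d : ℕ}

/-- An irreducible non-negative matrix is ergodic when it has no state `x` and no period `m ≥ 2`
such that `W ^ n` vanishes at `(x, x)` unless `m ∣ n`. -/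
def IsErgodic (W : Matrix X X ℝ) : Prop :=
  W.IsIrreducible ∧ ¬ ∃ (x : X) (m : ℕ), 2 ≤ m ∧ ∀ n : ℕ, ¬ m ∣ n → (W ^ n) x x = 0

/-- The Perron–Frobenius eigenvalue of a non-negative matrix: its spectral radius. -/
def pfEigenvalue (A : Matrix X X ℝ) : ℝ :=
  (spectralRadius ℂ (A.map ((↑) : ℝ → ℂ))).toReal

/-- `v` is the normalized Perron–Frobenius eigenvector of `A`. -/
def IsPFEigenvector (A : Matrix X X ℝ) (v : X → ℝ) : Prop :=
  (∀ x, 0 < v x) ∧ ∑ x, v x = 1 ∧ A *ᵥ v = pfEigenvalue A • v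

open Classical in
/-- The normalized Perron–Frobenius eigenvector. (It exists for every irreducible matrix; the
value for other matrices is irrelevant.) -/
def pfEigenvector (A : Matrix X X ℝ) : X → ℝ :=
  if h : ∃ v, IsPFEigenvector A v then h.choose else 1

/-- The functions `g j` are linearly independent under `W`: no non-trivial linear combination is
of the form `f x - f x' + b` on the support of `W`. -/
def IndependentUnder (W : Matrix X X ℝ) (g : Fin d → X → X → ℝ) : Prop :=
  ∀ c : Fin d → ℝ, c ≠ 0 →
    ¬ ∃ (f : X → ℝ) (b : ℝ), ∀ x x', 0 < W x x' → ∑ j, c j * g j x x' = f x - f x' + b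

/-- The tilted matrix `W(x|x') exp (∑ j, θ j * g j (x, x'))`. -/
def tilted (W : Matrix X X ℝ) (g : Fin d → X → X → ℝ) (θ : Fin d → ℝ) : Matrix X X ℝ :=
  Matrix.of fun x x' => W x x' * Real.exp (∑ j, θ j * g j x x')

/-- The potential function: the logarithm of the Perron–Frobenius eigenvalue. -/
def potential (W : Matrix X X ℝ) (g : Fin d → X → X → ℝ) (θ : Fin d → ℝ) : ℝ :=
  Real.log (pfEigenvalue (tilted W g θ))

/-- The member with natural parameter `θ` of the exponential family of transition matrices
generated by `W` with the generator `g`. -/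
def expFamily (W : Matrix X X ℝ) (g : Fin d → X → X → ℝ) (θ : Fin d → ℝ) : Matrix X X ℝ :=
  Matrix.of fun x x' =>
    (pfEigenvalue (tilted W g θ))⁻¹ * pfEigenvector (tilted W g θ)ᵀ x *
      tilted W g θ x x' * (pfEigenvector (tilted W g θ)ᵀ x')⁻¹

/-- The expectation parameter. -/
def expectationParam (W : Matrix X X ℝ) (g : Fin d → X → X → ℝ) (θ : Fin d → ℝ) : Fin d → ℝ :=
  gradVec (potential W g) θ

/-- The law of `n + 1` observations of the Markov chain with transition matrix `V` and initial
distribution `P`; the coordinate `z k` is the `(k+1)`-st observation. -/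
def pathLaw (V : Matrix X X ℝ) (P : X → ℝ) (n : ℕ) (z : Fin (n + 1) → X) : ℝ :=
  P (z 0) * ∏ k : Fin n, V (z k.succ) (z k.castSucc)

/-- The laws of `n + 1` observations for the exponential family of transition matrices, with the
initial distributions `P θ`. -/
def chainFamily (W : Matrix X X ℝ) (g : Fin d → X → X → ℝ) (P : (Fin d → ℝ) → X → ℝ) (n : ℕ)
    (θ : Fin d → ℝ) : (Fin (n + 1) → X) → ℝ :=
  pathLaw (expFamily W g θ) (P θ) n

/-- The vector sample mean of the generator over `n + 1` observations (`n` transitions). -/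
def sampleMean (g : Fin d → X → X → ℝ) (n : ℕ) (z : Fin (n + 1) → X) : Fin d → ℝ :=
  fun j => (∑ k : Fin n, g j (z k.succ) (z k.castSucc)) / n

end Markov

end MarkovExp

end

/-! Let ψ_θ be the logarithm of the left Perron–Frobenius eigenvector (`logPF`). By
`expFamily_apply`, W_θ(x|x') = W(x|x') exp(θ·g(x,x') − φ(θ) + ψ_θ(x) − ψ_θ(x')). Both φ and ψ are
smooth in θ: the Perron–Frobenius eigenvalue is simple, so the implicit function theorem applies to
the normalized eigenvector equation (`contDiff_pfEigenpair`). Differentiating ∑_x W_θ(x|x') = 1 once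
shows that the transition score s_i = g_i − η_i + ∂_iψ(x) − ∂_iψ(x') has conditional mean zero.
Differentiating again shows that the conditional mean of s_i s_j is H_ij minus the conditional mean
increment of ∂_i∂_jψ (`sum_expFamily_mul_score_mul_score`). Under the stationary law the increment
averages out, so H is the stationary covariance of s. Independence of the generators then makes H
positive definite, and η is injective because it is strictly monotone along segments.

Along the chain the sum of the scores is a martingale, and its second moments are nH up to a bounded
error for every initial distribution (`expect_pathSum_mul_pathSum`). Both n(sample mean − η) and the
score of the whole path differ from this martingale by bounded terms: the telescoped ∂ψ in the first
case, the score of the initial distribution in the second. By Cauchy–Schwarz such terms alter second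
moments by o(n) only (`tendsto_inv_mul_expect_perturb`). Hence the mean square error, the covariance
and the Fisher information all have the limit H. The change of parameters conjugates the information
by H⁻¹ (`fisherInfoReparam_eq`), and efficiency follows by continuity of matrix inversion. -/

noncomputable section

namespace MarkovExp

/-! ### Perron–Frobenius theory of irreducible matrices -/

section PerronFrobenius

variable {X : Type*} [Fintype X] [DecidableEq X] {A : Matrix X X ℝ}

omit [DecidableEq X] in
theorem mulVec_mono (hA : ∀ i j, 0 ≤ A i j) {y z : X → ℝ} (h : ∀ x, y x ≤ z x) (x : X) :
    (A *ᵥ y) x ≤ (A *ᵥ z) x :=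
  Finset.sum_le_sum fun j _ => mul_le_mul_of_nonneg_left (h j) (hA x j)

theorem pow_smul_le_pow_mulVec (hA : ∀ i j, 0 ≤ A i j) {y : X → ℝ} {s : ℝ} (hs : 0 ≤ s)
    (h : ∀ x, s * y x ≤ (A *ᵥ y) x) (k : ℕ) (x : X) : s ^ k * y x ≤ (A ^ k *ᵥ y) x := by
  induction k generalizing x with
  | zero => simp
  | succ k ih =>
    calc s ^ (k + 1) * y x = s ^ k * (s * y x) := by ring
      _ ≤ s ^ k * (A *ᵥ y) x := mul_le_mul_of_nonneg_left (h x) (pow_nonneg hs k)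
      _ = (A *ᵥ (s ^ k • y)) x := by simp [Matrix.mulVec_smul]
      _ ≤ (A *ᵥ (A ^ k *ᵥ y)) x := mulVec_mono hA (fun x => by simpa using ih x) x
      _ = _ := by rw [pow_succ', Matrix.mulVec_mulVec]

theorem pow_mulVec_eq {y : X → ℝ} {s : ℝ} (h : A *ᵥ y = s • y) (k : ℕ) :
    A ^ k *ᵥ y = s ^ k • y := by
  induction k with
  | zero => simp
  | succ k ih => rw [pow_succ, ← Matrix.mulVec_mulVec, h, Matrix.mulVec_smul, ih, smul_smul, pow_succ']

theorem map_pow_mulVec (k : ℕ) (y : X → ℝ) (x : X) :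
    ((A.map ((↑) : ℝ → ℂ)) ^ k *ᵥ (fun x => (y x : ℂ))) x = (((A ^ k *ᵥ y) x : ℝ) : ℂ) := by
  have h := RingHom.map_mulVec Complex.ofRealHom (A ^ k) y x
  have h2 : (A ^ k).map Complex.ofRealHom = (A.map Complex.ofRealHom) ^ k :=
    Matrix.map_pow A Complex.ofRealHom k
  rw [h2] at h
  exact h.symm

section Spectral

attribute [local instance] Matrix.linftyOpNormedRing Matrix.linftyOpNormedAlgebra

-- The spectral radius is attained on the spectrum, whose points are eigenvalues in finite
-- dimension. Finiteness is recorded because `pfEigenvalue` takes a `toReal`, which would send `⊤`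
-- to `0`.
variable (A) in
theorem exists_eigenvector_norm_eq_pfEigenvalue [Nonempty X] :
    spectralRadius ℂ (A.map ((↑) : ℝ → ℂ)) ≠ ⊤ ∧
    ∃ (μ : ℂ) (w : X → ℂ), w ≠ 0 ∧ ‖μ‖ = pfEigenvalue A ∧
      A.map ((↑) : ℝ → ℂ) *ᵥ w = μ • w := by
  obtain ⟨μ, hμ, hr⟩ := spectrum.exists_nnnorm_eq_spectralRadius (A.map ((↑) : ℝ → ℂ))
  refine ⟨hr ▸ ENNReal.coe_ne_top, μ, ?_⟩
  rw [← Matrix.spectrum_toLin', ← Module.End.hasEigenvalue_iff_mem_spectrum] at hμ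
  obtain ⟨w, hw⟩ := hμ.exists_hasEigenvector
  refine ⟨w, hw.2, ?_, by simpa using hw.apply_eq_smul⟩
  rw [pfEigenvalue, ← hr]
  simp

/-- The Collatz–Wielandt lower bound. -/
theorem le_pfEigenvalue [Nonempty X] (hA : ∀ i j, 0 ≤ A i j) {y : X → ℝ} (hy : ∀ x, 0 ≤ y x)
    (hy0 : y ≠ 0) {s : ℝ} (hs : 0 ≤ s) (h : ∀ x, s * y x ≤ (A *ᵥ y) x) :
    s ≤ pfEigenvalue A := by
  obtain ⟨x, hx⟩ := Function.ne_iff.mp hy0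
  have hx : 0 < y x := lt_of_le_of_ne (hy x) (Ne.symm hx)
  set B : Matrix X X ℂ := A.map ((↑) : ℝ → ℂ) with hB
  set yc : X → ℂ := fun x => (y x : ℂ) with hyc
  have hyc0 : 0 < ‖yc‖ := norm_pos_iff.mpr fun h0 => hx.ne' (by simpa [hyc] using congrFun h0 x)
  set C := y x / ‖yc‖
  have hC : 0 < C := div_pos hx hyc0
  -- Evaluate the iterated inequality at a coordinate where `y` is positive. Gelfand's formula then
  -- gives the bound, as the constant `C` disappears under k-th roots.
  have hk (k : ℕ) : C * s ^ k ≤ ‖B ^ k‖ := by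
    have h1 := (norm_le_pi_norm (B ^ k *ᵥ yc) x).trans (Matrix.linfty_opNorm_mulVec _ _)
    rw [map_pow_mulVec, Complex.norm_real] at h1
    have h2 := (pow_smul_le_pow_mulVec hA hs h k x).trans ((le_abs_self _).trans h1)
    rw [div_mul_eq_mul_div, div_le_iff₀ hyc0]
    linarith
  have hlim := (ENNReal.tendsto_toReal (exists_eigenvector_norm_eq_pfEigenvalue A).1).comp
    (spectrum.pow_nnnorm_pow_one_div_tendsto_nhds_spectralRadius B)
  have hlim2 : Tendsto (fun k : ℕ => C ^ (1 / (k : ℝ)) * s) atTop (𝓝 (C ^ (0 : ℝ) * s)) :=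
    ((tendsto_const_nhds.rpow tendsto_one_div_atTop_nhds_zero_nat (Or.inl hC.ne'))).mul_const s
  rw [Real.rpow_zero, one_mul] at hlim2
  refine le_of_tendsto_of_tendsto hlim2 hlim ?_
  filter_upwards [eventually_gt_atTop 0] with k hk0
  have hk0' : (k : ℝ) ≠ 0 := by positivity
  have : C ^ (1 / (k : ℝ)) * s = (C * s ^ k) ^ (1 / (k : ℝ)) := by
    rw [Real.mul_rpow hC.le (by positivity), ← Real.rpow_natCast, ← Real.rpow_mul hs]
    simp [hk0']
  rw [this]
  have h3 := Real.rpow_le_rpow (by positivity) (hk k) (z := 1 / (k : ℝ)) (by positivity)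
  simpa [← ENNReal.toReal_rpow] using h3

end Spectral

theorem pfEigenvalue_nonneg (A : Matrix X X ℝ) : 0 ≤ pfEigenvalue A := ENNReal.toReal_nonneg

/-- A positive eigenvector of a non-negative matrix belongs to the spectral radius. -/
theorem eigenvalue_eq_pfEigenvalue [Nonempty X] (hA : ∀ i j, 0 ≤ A i j) {v : X → ℝ}
    (hv : ∀ x, 0 < v x) {s : ℝ} (h : A *ᵥ v = s • v) : s = pfEigenvalue A := by
  obtain ⟨x₀⟩ := ‹Nonempty X›
  have : Nonempty X := ⟨x₀⟩
  have hs : 0 ≤ s := by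
    have h1 : 0 ≤ (A *ᵥ v) x₀ := Finset.sum_nonneg fun j _ => mul_nonneg (hA x₀ j) (hv j).le
    rw [h] at h1
    exact nonneg_of_mul_nonneg_left h1 (hv x₀)
  refine le_antisymm (le_pfEigenvalue hA (fun x => (hv x).le)
    (fun h0 => (hv x₀).ne' (congrFun h0 x₀)) hs fun x => by simp [h]) ?_
  obtain ⟨-, μ, w, hw0, hμ, hw⟩ := exists_eigenvector_norm_eq_pfEigenvalue A
  -- Here `c * v` dominates `‖w‖` with equality at `x`; the triangle inequality in the eigenvalue
  -- equation of `w` at `x` bounds `‖μ‖` by `s`.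
  obtain ⟨x, -, hx⟩ := Finset.exists_max_image Finset.univ (fun x => ‖w x‖ / v x)
    Finset.univ_nonempty
  set c := ‖w x‖ / v x
  have hc (j : X) : ‖w j‖ ≤ c * v j := (div_le_iff₀ (hv j)).mp (hx j (Finset.mem_univ j))
  have hc0 : 0 < c := by
    obtain ⟨j, hj⟩ := Function.ne_iff.mp hw0
    exact pos_of_mul_pos_left ((norm_pos_iff.mpr hj).trans_le (hc j)) (hv j).le
  have h1 : pfEigenvalue A * (c * v x) ≤ s * (c * v x) := by
    have e : c * v x = ‖w x‖ := div_mul_cancel₀ _ (hv x).ne'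
    calc pfEigenvalue A * (c * v x) = ‖(A.map ((↑) : ℝ → ℂ) *ᵥ w) x‖ := by
          rw [e, hw, ← hμ]; simp
      _ ≤ ∑ j, A x j * (c * v j) := by
          refine (norm_sum_le _ _).trans (Finset.sum_le_sum fun j _ => ?_)
          simp only [Matrix.map_apply, norm_mul, Complex.norm_real, Real.norm_eq_abs,
            abs_of_nonneg (hA x j)]
          exact mul_le_mul_of_nonneg_left (hc j) (hA x j)
      _ = c * (A *ᵥ v) x := by
          simp only [Matrix.mulVec, dotProduct, Finset.mul_sum]
          exact Finset.sum_congr rfl fun j _ => by ring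
      _ = s * (c * v x) := by rw [h]; simp; ring
  exact le_of_mul_le_mul_right h1 (mul_pos hc0 (hv x))

/-- Some power of `A` has a positive entry from the support of `y` to `x`, and that power multiplies
`y` by a scalar, so `y x` cannot vanish. -/
theorem pos_of_eigenvector (hA : A.IsIrreducible) {y : X → ℝ} (hy : ∀ x, 0 ≤ y x) (hy0 : y ≠ 0)
    {s : ℝ} (h : A *ᵥ y = s • y) (x : X) : 0 < y x := by
  obtain ⟨x₀, hx₀⟩ := Function.ne_iff.mp hy0
  obtain ⟨k, -, hk⟩ := (Matrix.isIrreducible_iff_exists_pow_pos hA.nonneg).mp hA x x₀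
  have h1 : 0 < (A ^ k *ᵥ y) x :=
    (mul_pos hk (lt_of_le_of_ne (hy x₀) (Ne.symm hx₀))).trans_le
      (Finset.single_le_sum (f := fun j => (A ^ k) x j * y j)
        (fun j _ => mul_nonneg (Matrix.pow_apply_nonneg hA.nonneg k x j) (hy j))
        (Finset.mem_univ x₀))
  rw [pow_mulVec_eq h] at h1
  refine lt_of_le_of_ne (hy x) fun h0 => ?_
  simp [← h0] at h1

/-- The eigenspace of a positive eigenvector of an irreducible matrix is one-dimensional. -/
theorem eigenvector_unique [Nonempty X] (hA : A.IsIrreducible) {v u : X → ℝ}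
    (hv : ∀ x, 0 < v x) {s : ℝ} (h : A *ᵥ v = s • v) (hu : A *ᵥ u = s • u) :
    ∃ c : ℝ, u = c • v := by
  -- With the minimal ratio as `c`, the vector `u - c • v` is non-negative and vanishes at `x`; were
  -- it non-zero, it would be a strictly positive eigenvector.
  obtain ⟨x, -, hx⟩ := Finset.exists_min_image Finset.univ (fun x => u x / v x)
    Finset.univ_nonempty
  refine ⟨u x / v x, ?_⟩
  set c := u x / v x with hc
  by_contra hne
  have := pos_of_eigenvector hA (y := u - c • v) (s := s)
    (fun j => by
      have := (le_div_iff₀ (hv j)).mp (hx j (Finset.mem_univ j))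
      simpa using this) (sub_ne_zero.mpr hne)
    (by rw [Matrix.mulVec_sub, Matrix.mulVec_smul, h, hu]; ext; simp; ring) x
  simp [hc, (hv x).ne'] at this

/-- A matrix with positive entries commuting with an irreducible matrix. -/
theorem exists_pos_commute (hA : A.IsIrreducible) :
    ∃ B : Matrix X X ℝ, (∀ i j, 0 < B i j) ∧ A * B = B * A := by
  choose k _ hk using (Matrix.isIrreducible_iff_exists_pow_pos hA.nonneg).mp hA
  refine ⟨∑ p : X × X, A ^ k p.1 p.2, fun i j => ?_, ?_⟩
  · rw [Matrix.sum_apply]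
    exact Finset.sum_pos' (fun p _ => Matrix.pow_apply_nonneg hA.nonneg _ _ _)
      ⟨(i, j), Finset.mem_univ _, hk i j⟩
  · exact (Commute.sum_right _ _ _ fun p _ => Commute.pow_right (Commute.refl A) _)

/-- Perron–Frobenius: existence of the normalized positive eigenvector. -/
theorem exists_isPFEigenvector [Nonempty X] (hA : A.IsIrreducible) :
    ∃ v, IsPFEigenvector A v := by
  obtain ⟨-, μ, w, hw0, hμ, hw⟩ := exists_eigenvector_norm_eq_pfEigenvalue A
  set y : X → ℝ := fun x => ‖w x‖ with hy
  set r := pfEigenvalue A with hr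
  have hr0 : 0 ≤ r := pfEigenvalue_nonneg A
  have hy0 : y ≠ 0 := by
    obtain ⟨j, hj⟩ := Function.ne_iff.mp hw0
    exact fun h0 => hj (norm_eq_zero.mp (congrFun h0 j))
  have hle (x : X) : r * y x ≤ (A *ᵥ y) x := by
    calc r * y x = ‖(A.map ((↑) : ℝ → ℂ) *ᵥ w) x‖ := by rw [hw, ← hμ]; simp [hy]
      _ ≤ ∑ j, A x j * y j := by
          refine (norm_sum_le _ _).trans (Finset.sum_le_sum fun j _ => ?_)
          simp [Matrix.map_apply, hy, abs_of_nonneg (hA.nonneg x j)]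
  -- Otherwise multiplication by the positive commuting matrix `B` turns `r • y ≤ A *ᵥ y` into an
  -- inequality strict at every coordinate for `B *ᵥ y`, which contradicts the Collatz–Wielandt
  -- bound.
  have heq : A *ᵥ y = r • y := by
    by_contra hne
    obtain ⟨B, hB, hAB⟩ := exists_pos_commute hA
    have hpos {z : X → ℝ} (hz : ∀ x, 0 ≤ z x) (hz0 : z ≠ 0) (x : X) : 0 < (B *ᵥ z) x := by
      obtain ⟨j, hj⟩ := Function.ne_iff.mp hz0
      exact Finset.sum_pos' (fun i _ => mul_nonneg (hB x i).le (hz i))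
        ⟨j, Finset.mem_univ j, mul_pos (hB x j) (lt_of_le_of_ne (hz j) (Ne.symm hj))⟩
    have hz := hpos (z := A *ᵥ y - r • y) (fun x => by simpa using hle x) (sub_ne_zero.mpr hne)
    have hy' := hpos (z := y) (fun x => norm_nonneg _) hy0
    set y' := B *ᵥ y
    have e : B *ᵥ (A *ᵥ y - r • y) = A *ᵥ y' - r • y' := by
      rw [Matrix.mulVec_sub, Matrix.mulVec_smul, Matrix.mulVec_mulVec, Matrix.mulVec_mulVec, hAB]
    rw [e] at hz
    obtain ⟨x, -, hx⟩ := Finset.exists_min_image Finset.univ (fun x => (A *ᵥ y') x / y' x)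
      Finset.univ_nonempty
    have h1 : r < (A *ᵥ y') x / y' x := by
      rw [lt_div_iff₀ (hy' x)]; simpa using hz x
    exact absurd (le_pfEigenvalue hA.nonneg (fun x => (hy' x).le)
      (fun h0 => (hy' x).ne' (congrFun h0 x)) (hr0.trans h1.le)
      fun j => (le_div_iff₀ (hy' j)).mp (hx j (Finset.mem_univ j))) (not_le.mpr h1)
  have hypos := pos_of_eigenvector hA (fun x => norm_nonneg _) hy0 heq
  have hS : 0 < ∑ x, y x := Finset.sum_pos (fun x _ => hypos x) Finset.univ_nonempty
  refine ⟨(∑ x, y x)⁻¹ • y, fun x => mul_pos (inv_pos.mpr hS) (hypos x), ?_, ?_⟩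
  · simp only [Pi.smul_apply, smul_eq_mul, ← Finset.mul_sum]
    exact inv_mul_cancel₀ hS.ne'
  · rw [Matrix.mulVec_smul, heq, smul_comm]

theorem isPFEigenvector_pfEigenvector [Nonempty X] (hA : A.IsIrreducible) :
    IsPFEigenvector A (pfEigenvector A) := by
  have h := exists_isPFEigenvector hA
  rw [pfEigenvector, dif_pos h]
  exact h.choose_spec

theorem eq_pfEigenvector [Nonempty X] (hA : A.IsIrreducible) {v : X → ℝ} (hv : ∀ x, 0 < v x)
    (hsum : ∑ x, v x = 1) {s : ℝ} (h : A *ᵥ v = s • v) :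
    s = pfEigenvalue A ∧ v = pfEigenvector A := by
  obtain ⟨h1, h2, h3⟩ := isPFEigenvector_pfEigenvector hA
  have hs := eigenvalue_eq_pfEigenvalue hA.nonneg hv h
  refine ⟨hs, ?_⟩
  obtain ⟨c, hc⟩ := eigenvector_unique hA h1 h3 (hs ▸ h)
  have : c = 1 := by
    rw [hc] at hsum
    simpa [← Finset.mul_sum, h2] using hsum
  simpa [this] using hc

theorem pfEigenvalue_pos [Nonempty X] (hA : A.IsIrreducible) : 0 < pfEigenvalue A := by
  obtain ⟨h1, -, h3⟩ := isPFEigenvector_pfEigenvector hA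
  refine lt_of_le_of_ne (pfEigenvalue_nonneg A) fun h0 => ?_
  obtain ⟨x⟩ := ‹Nonempty X›
  obtain ⟨k, hk0, hk⟩ := (Matrix.isIrreducible_iff_exists_pow_pos hA.nonneg).mp hA x x
  have h4 : 0 < (A ^ k *ᵥ pfEigenvector A) x :=
    Finset.sum_pos' (fun j _ => mul_nonneg (Matrix.pow_apply_nonneg hA.nonneg k x j) (h1 j).le)
      ⟨x, Finset.mem_univ x, mul_pos hk (h1 x)⟩
  rw [pow_mulVec_eq h3, ← h0] at h4
  simp [hk0.ne'] at h4

/-- Pair the positive left and right eigenvectors through `A`: their inner product is positive and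
can be cancelled. -/
theorem pfEigenvalue_transpose [Nonempty X] (hA : A.IsIrreducible) :
    pfEigenvalue Aᵀ = pfEigenvalue A := by
  obtain ⟨h1, -, h3⟩ := isPFEigenvector_pfEigenvector hA
  obtain ⟨k1, -, k3⟩ := isPFEigenvector_pfEigenvector hA.transpose
  have h := Matrix.dotProduct_mulVec (pfEigenvector Aᵀ) A (pfEigenvector A)
  rw [← Matrix.mulVec_transpose, h3, k3, dotProduct_smul, smul_dotProduct] at h
  have hpos : 0 < pfEigenvector Aᵀ ⬝ᵥ pfEigenvector A :=
    Finset.sum_pos (fun x _ => mul_pos (k1 x) (h1 x)) Finset.univ_nonempty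
  exact (mul_right_cancel₀ hpos.ne' h).symm

-- Irreducibility depends only on the support, so it passes to the tilted matrices and to the
-- exponential family.
omit [Fintype X] [DecidableEq X] in
theorem isIrreducible_of_pos_iff {B : Matrix X X ℝ} (hA : A.IsIrreducible)
    (hB : ∀ i j, 0 ≤ B i j) (h : ∀ i j, 0 < B i j ↔ 0 < A i j) : B.IsIrreducible := by
  have e : B.toQuiver = A.toQuiver := by
    unfold Matrix.toQuiver
    simp only [h]
  exact ⟨hB, e ▸ hA.connected⟩

end PerronFrobenius

/-! ### Smooth dependence of the Perron–Frobenius eigenpair on parameters -/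

section PerronFrobeniusSmooth

variable {X : Type*} [Fintype X] [DecidableEq X]
  {E : Type*} [NormedAddCommGroup E] [NormedSpace ℝ E]

/-- The zero set of `θ, v, s ↦ eigenEquation A (θ, v, s) - (0, 1)` consists of the normalized
eigenpairs `(v, s)` of `A θ`. -/
def eigenEquation (A : E → Matrix X X ℝ) (u : E × (X → ℝ) × ℝ) : (X → ℝ) × ℝ :=
  (A u.1 *ᵥ u.2.1 - u.2.2 • u.2.1, ∑ x, u.2.1 x)

omit [DecidableEq X] in
theorem contDiff_eigenEquation {n : ℕ∞ω} {A : E → Matrix X X ℝ}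
    (hA : ∀ x x', ContDiff ℝ n fun θ => A θ x x') : ContDiff ℝ n (eigenEquation A) := by
  refine ContDiff.prodMk (contDiff_pi.mpr fun x => ?_) (ContDiff.sum fun x _ => by fun_prop)
  simp only [Pi.sub_apply, Pi.smul_apply, smul_eq_mul, Matrix.mulVec, dotProduct]
  refine ContDiff.sub (ContDiff.sum fun x' _ => ?_) (by fun_prop)
  exact ((hA x x').comp contDiff_fst).mul (by fun_prop)

-- This is the partial derivative in the eigenpair, whose invertibility the implicit function
-- theorem requires.
omit [DecidableEq X] in
theorem fderiv_eigenEquation_inr {A : E → Matrix X X ℝ} {u : E × (X → ℝ) × ℝ}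
    (h : DifferentiableAt ℝ (eigenEquation A) u) (p : (X → ℝ) × ℝ) :
    (fderiv ℝ (eigenEquation A) u ∘L .inr ℝ E ((X → ℝ) × ℝ)) p =
      (A u.1 *ᵥ p.1 - u.2.2 • p.1 - p.2 • u.2.1, ∑ x, p.1 x) := by
  have h1 : HasDerivAt (fun t : ℝ => eigenEquation A (u + t • ((0 : E), p)))
      (fderiv ℝ (eigenEquation A) u (0, p)) 0 := h.hasFDerivAt.hasLineDerivAt (0, p)
  refine h1.unique (HasDerivAt.prodMk (hasDerivAt_pi.mpr fun x => ?_) ?_)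
  · have e : (fun t : ℝ => ((A (u + t • ((0 : E), p)).1 *ᵥ (u + t • ((0 : E), p)).2.1 -
        (u + t • ((0 : E), p)).2.2 • (u + t • ((0 : E), p)).2.1) : X → ℝ) x) =
        fun t : ℝ => ((A u.1 *ᵥ u.2.1) x + t * (A u.1 *ᵥ p.1) x) -
          (u.2.2 + t * p.2) * (u.2.1 x + t * p.1 x) := by
      funext t
      simp [Matrix.mulVec_add, Matrix.mulVec_smul]
      ring
    have lin (a b : ℝ) : HasDerivAt (fun t : ℝ => a + t * b) b 0 := by
      simpa using ((hasDerivAt_id (0 : ℝ)).mul_const b).const_add a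
    have h2 := (lin ((A u.1 *ᵥ u.2.1) x) ((A u.1 *ᵥ p.1) x)).fun_sub
      ((lin u.2.2 p.2).fun_mul (lin (u.2.1 x) (p.1 x)))
    rw [← e] at h2
    refine h2.congr_deriv ?_
    simp
    ring
  · refine HasDerivAt.fun_sum fun x _ => ?_
    simpa using ((hasDerivAt_id (0 : ℝ)).mul_const (p.1 x)).const_add (u.2.1 x)

variable [CompleteSpace E] [Nonempty X]

/-- The Perron–Frobenius eigenvalue and eigenvector depend smoothly on the matrix. -/
theorem contDiff_pfEigenpair {n : ℕ∞ω} (hn : n ≠ 0) {A : E → Matrix X X ℝ}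
    (hA : ∀ x x', ContDiff ℝ n fun θ => A θ x x') (hirr : ∀ θ, (A θ).IsIrreducible) :
    ContDiff ℝ n fun θ => (pfEigenvector (A θ), pfEigenvalue (A θ)) := by
  refine contDiff_iff_contDiffAt.mpr fun θ₀ => ?_
  obtain ⟨hv, hv1, hveq⟩ := isPFEigenvector_pfEigenvector (hirr θ₀)
  obtain ⟨hw, -, hweq⟩ := isPFEigenvector_pfEigenvector (hirr θ₀).transpose
  rw [pfEigenvalue_transpose (hirr θ₀)] at hweq
  set v := pfEigenvector (A θ₀) with hvdef
  set r := pfEigenvalue (A θ₀) with hrdef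
  set w := pfEigenvector (A θ₀)ᵀ
  set u : E × (X → ℝ) × ℝ := (θ₀, v, r) with hu
  have cdf : ContDiffAt ℝ n (eigenEquation A) u := (contDiff_eigenEquation hA).contDiffAt
  have hinv : (fderiv ℝ (eigenEquation A) u ∘L .inr ℝ E ((X → ℝ) × ℝ)).IsInvertible := by
    set L := fderiv ℝ (eigenEquation A) u ∘L .inr ℝ E ((X → ℝ) × ℝ) with hL
    -- Pairing with the left eigenvector `w` annihilates the range of `A θ₀ - r`, which forces `p.2
    -- = 0`. Then `p.1` is a multiple of `v` with coordinate sum zero, hence zero.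
    have hinj : Function.Injective (L : (X → ℝ) × ℝ →ₗ[ℝ] (X → ℝ) × ℝ) := by
      refine (injective_iff_map_eq_zero _).mpr fun p hp => ?_
      have hp' : L p = 0 := hp
      rw [hL, fderiv_eigenEquation_inr (cdf.differentiableAt hn), Prod.mk_eq_zero] at hp'
      obtain ⟨h1, h2⟩ := hp'
      have h3 : w ⬝ᵥ (A θ₀ *ᵥ p.1) = r * (w ⬝ᵥ p.1) := by
        rw [Matrix.dotProduct_mulVec, ← Matrix.mulVec_transpose, hweq, smul_dotProduct, smul_eq_mul]
      have h4 : 0 < w ⬝ᵥ v := Finset.sum_pos (fun x _ => mul_pos (hw x) (hv x))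
        Finset.univ_nonempty
      have h5 := congrArg (w ⬝ᵥ ·) h1
      simp only [dotProduct_sub, dotProduct_smul, smul_eq_mul, dotProduct_zero, hu, h3] at h5
      have h6 : p.2 = 0 := by
        have : p.2 * (w ⬝ᵥ v) = 0 := by linarith
        exact (mul_eq_zero.mp this).resolve_right h4.ne'
      rw [h6, zero_smul, sub_zero, sub_eq_zero] at h1
      obtain ⟨c, hc⟩ := eigenvector_unique (hirr θ₀) hv hveq h1
      have h7 : c = 0 := by
        rw [hc] at h2
        simpa [← Finset.mul_sum, hv1] using h2
      exact Prod.ext (by rw [hc, h7, zero_smul]; rfl) h6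
    exact ⟨(LinearEquiv.ofInjectiveEndo _ hinj).toContinuousLinearEquiv, by ext <;> rfl⟩
  have hψ := cdf.contDiffAt_implicitFunction hn hinv
  have hψ0 := cdf.implicitFunction_apply_self hn hinv
  have hψe := cdf.eventually_apply_implicitFunction hn hinv
  set ψ := cdf.implicitFunction hn hinv
  refine hψ.congr_of_eventuallyEq ?_
  -- Positivity persists near `θ₀`, and a positive normalized eigenvector is unique, so the implicit
  -- function is the Perron–Frobenius pair.
  have hpos : ∀ᶠ θ in 𝓝 u.1, ∀ x, 0 < (ψ θ).1 x := by
    refine Filter.eventually_all.mpr fun x => ?_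
    have hc : ContinuousAt (fun θ => (ψ θ).1 x) u.1 :=
      (continuous_apply x).continuousAt.comp (continuous_fst.continuousAt.comp hψ.continuousAt)
    exact hc.eventually (lt_mem_nhds (by simpa [hψ0] using hv x))
  filter_upwards [hpos, hψe] with θ h1 h2
  have h3 : eigenEquation A u = (0, 1) := by simp [eigenEquation, hu, hveq, hv1]
  rw [h3, eigenEquation, Prod.mk.injEq, sub_eq_zero] at h2
  obtain ⟨e1, e2⟩ := eq_pfEigenvector (hirr θ) h1 h2.2 h2.1
  exact Prod.ext e2.symm e1.symm

end PerronFrobeniusSmooth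

/-! ### Partial derivatives of smooth functions -/

section PartialDerivatives

variable {d : ℕ} {f : (Fin d → ℝ) → ℝ}

theorem partialDeriv_eq_fderiv {θ : Fin d → ℝ} (hf : DifferentiableAt ℝ f θ) (i : Fin d) :
    partialDeriv f i θ = fderiv ℝ f θ (Pi.single i 1) :=
  hf.lineDeriv_eq_fderiv

theorem hasLineDerivAt_partialDeriv {θ : Fin d → ℝ} (hf : DifferentiableAt ℝ f θ) (i : Fin d) :
    HasLineDerivAt ℝ f (partialDeriv f i θ) θ (Pi.single i 1) :=
  hf.lineDifferentiableAt.hasLineDerivAt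

theorem fderiv_apply_eq_sum {θ : Fin d → ℝ} (hf : DifferentiableAt ℝ f θ) (v : Fin d → ℝ) :
    fderiv ℝ f θ v = ∑ i, v i * partialDeriv f i θ := by
  conv_lhs => rw [pi_eq_sum_univ' v]
  simp [partialDeriv_eq_fderiv hf]

theorem contDiff_partialDeriv (hf : ContDiff ℝ ∞ f) (i : Fin d) :
    ContDiff ℝ ∞ (partialDeriv f i) := by
  have e : partialDeriv f i = fun θ => fderiv ℝ f θ (Pi.single i 1) :=
    funext fun θ => partialDeriv_eq_fderiv (hf.differentiable (by simp) θ) i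
  rw [e]
  exact (hf.fderiv_right (m := ∞) (by simp)).clm_apply contDiff_const

end PartialDerivatives

/-! ### The exponential family of transition matrices and the Hesse matrix of its potential -/

section ExponentialFamily

variable {X : Type*} [Fintype X] [DecidableEq X] {d : ℕ} {W : Matrix X X ℝ}

omit [Fintype X] [DecidableEq X] in
theorem tilted_isIrreducible (hW : W.IsIrreducible) (g : Fin d → X → X → ℝ) (θ : Fin d → ℝ) :
    (tilted W g θ).IsIrreducible :=
  isIrreducible_of_pos_iff hW (fun x x' => mul_nonneg (hW.nonneg x x') (Real.exp_pos _).le)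
    fun x x' => by simp [tilted, Real.exp_pos]

/-- The logarithm of the Perron–Frobenius eigenvector of the transposed tilted matrix. -/
def logPF (W : Matrix X X ℝ) (g : Fin d → X → X → ℝ) (x : X) (θ : Fin d → ℝ) : ℝ :=
  Real.log (pfEigenvector (tilted W g θ)ᵀ x)

theorem contDiff_pfEigenpair_tilted [Nonempty X] (hW : W.IsIrreducible)
    (g : Fin d → X → X → ℝ) : ContDiff ℝ ∞ fun θ =>
      (pfEigenvector (tilted W g θ)ᵀ, pfEigenvalue (tilted W g θ)ᵀ) := by
  refine contDiff_pfEigenpair (by simp) (fun x x' => ?_)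
    fun θ => (tilted_isIrreducible hW g θ).transpose
  simp only [tilted, Matrix.transpose_apply, Matrix.of_apply]
  fun_prop

theorem contDiff_potential [Nonempty X] (hW : W.IsIrreducible) (g : Fin d → X → X → ℝ) :
    ContDiff ℝ ∞ (potential W g) := by
  have h := (contDiff_pfEigenpair_tilted hW g).snd
  simp only [pfEigenvalue_transpose (tilted_isIrreducible hW g _)] at h
  exact h.log fun θ => (pfEigenvalue_pos (tilted_isIrreducible hW g θ)).ne'

theorem contDiff_logPF [Nonempty X] (hW : W.IsIrreducible) (g : Fin d → X → X → ℝ) (x : X) :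
    ContDiff ℝ ∞ (logPF W g x) :=
  (contDiff_pi.mp (contDiff_pfEigenpair_tilted hW g).fst x).log fun θ =>
    ((isPFEigenvector_pfEigenvector (tilted_isIrreducible hW g θ).transpose).1 x).ne'

/-- In this form the parameter enters only through an exponent, so the support is fixed and the
derivative of the exponent is the score. -/
theorem expFamily_apply [Nonempty X] (hW : W.IsIrreducible) (g : Fin d → X → X → ℝ)
    (θ : Fin d → ℝ) (x x' : X) : expFamily W g θ x x' =
      W x x' * Real.exp (∑ j, θ j * g j x x' - potential W g θ + logPF W g x θ
        - logPF W g x' θ) := by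
  have hv := (isPFEigenvector_pfEigenvector (tilted_isIrreducible hW g θ).transpose).1
  rw [Real.exp_sub, Real.exp_add, Real.exp_sub, potential, logPF, logPF,
    Real.exp_log (pfEigenvalue_pos (tilted_isIrreducible hW g θ)), Real.exp_log (hv x),
    Real.exp_log (hv x')]
  simp only [expFamily, tilted, Matrix.of_apply]
  ring

theorem expFamily_nonneg [Nonempty X] (hW : W.IsIrreducible) (g : Fin d → X → X → ℝ)
    (θ : Fin d → ℝ) (x x' : X) : 0 ≤ expFamily W g θ x x' := by
  rw [expFamily_apply hW]
  exact mul_nonneg (hW.nonneg x x') (Real.exp_pos _).le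

theorem expFamily_pos_iff [Nonempty X] (hW : W.IsIrreducible) (g : Fin d → X → X → ℝ)
    (θ : Fin d → ℝ) (x x' : X) : 0 < expFamily W g θ x x' ↔ 0 < W x x' := by
  rw [expFamily_apply hW]
  simp [Real.exp_pos]

theorem sum_expFamily [Nonempty X] (hW : W.IsIrreducible) (g : Fin d → X → X → ℝ)
    (θ : Fin d → ℝ) (x' : X) : ∑ x, expFamily W g θ x x' = 1 := by
  have hirr := tilted_isIrreducible hW g θ
  obtain ⟨hv, -, he⟩ := isPFEigenvector_pfEigenvector hirr.transpose
  have h := congrFun he x'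
  rw [pfEigenvalue_transpose hirr] at h
  simp only [Matrix.mulVec, dotProduct, Matrix.transpose_apply, Pi.smul_apply, smul_eq_mul] at h
  calc ∑ x, expFamily W g θ x x'
      = (pfEigenvalue (tilted W g θ))⁻¹ * (pfEigenvector (tilted W g θ)ᵀ x')⁻¹ *
        ∑ x, tilted W g θ x x' * pfEigenvector (tilted W g θ)ᵀ x := by
        rw [Finset.mul_sum]
        exact Finset.sum_congr rfl fun x _ => by simp only [expFamily, Matrix.of_apply]; ring
    _ = 1 := by
        rw [h]
        have := (pfEigenvalue_pos hirr).ne'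
        have := (hv x').ne'
        field_simp

/-- The score of a single transition. -/
def transitionScore (W : Matrix X X ℝ) (g : Fin d → X → X → ℝ) (θ : Fin d → ℝ) (i : Fin d)
    (x x' : X) : ℝ :=
  g i x x' - expectationParam W g θ i + partialDeriv (logPF W g x) i θ
    - partialDeriv (logPF W g x') i θ

variable [Nonempty X]

theorem hasLineDerivAt_logDensity (hW : W.IsIrreducible) (g : Fin d → X → X → ℝ) (θ : Fin d → ℝ)
    (i : Fin d) (x x' : X) :
    HasLineDerivAt ℝ (fun θ => ∑ j, θ j * g j x x' - potential W g θ + logPF W g x θ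
      - logPF W g x' θ) (transitionScore W g θ i x x') θ (Pi.single i 1) := by
  have h1 : HasLineDerivAt ℝ (fun θ : Fin d → ℝ => ∑ j, θ j * g j x x') (g i x x') θ
      (Pi.single i 1) := by
    have : HasDerivAt (fun t : ℝ => ∑ j, (θ + t • (Pi.single i (1 : ℝ) : Fin d → ℝ)) j * g j x x')
        (∑ j, (Pi.single i (1 : ℝ) : Fin d → ℝ) j * g j x x') 0 := by
      refine HasDerivAt.fun_sum fun j _ => HasDerivAt.mul_const ?_ _
      simpa using ((hasDerivAt_id (0 : ℝ)).mul_const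
        ((Pi.single i (1 : ℝ) : Fin d → ℝ) j)).const_add (θ j)
    simpa [HasLineDerivAt, Pi.single_apply] using this
  have h2 := hasLineDerivAt_partialDeriv ((contDiff_potential hW g).differentiable (by simp) θ) i
  have h3 := hasLineDerivAt_partialDeriv ((contDiff_logPF hW g x).differentiable (by simp) θ) i
  have h4 := hasLineDerivAt_partialDeriv ((contDiff_logPF hW g x').differentiable (by simp) θ) i
  exact ((HasDerivAt.fun_sub h1 h2).fun_add h3).fun_sub h4

theorem hasLineDerivAt_expFamily (hW : W.IsIrreducible) (g : Fin d → X → X → ℝ) (θ : Fin d → ℝ)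
    (i : Fin d) (x x' : X) :
    HasLineDerivAt ℝ (fun θ => expFamily W g θ x x')
      (expFamily W g θ x x' * transitionScore W g θ i x x') θ (Pi.single i 1) := by
  have h := (HasDerivAt.exp (hasLineDerivAt_logDensity hW g θ i x x')).const_mul (W x x')
  simp only [zero_smul, add_zero, ← mul_assoc] at h
  simp only [expFamily_apply hW]
  exact h

/-- The second derivatives of the logarithm of the Perron–Frobenius eigenvector. -/
def hesseLogPF (W : Matrix X X ℝ) (g : Fin d → X → X → ℝ) (θ : Fin d → ℝ) (i j : Fin d)
    (x : X) : ℝ :=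
  hesse (logPF W g x) θ i j

theorem hasLineDerivAt_transitionScore (hW : W.IsIrreducible) (g : Fin d → X → X → ℝ)
    (θ : Fin d → ℝ) (i j : Fin d) (x x' : X) :
    HasLineDerivAt ℝ (fun θ => transitionScore W g θ j x x')
      (-hesse (potential W g) θ i j + hesseLogPF W g θ i j x - hesseLogPF W g θ i j x')
      θ (Pi.single i 1) := by
  have h2 := hasLineDerivAt_partialDeriv
    ((contDiff_partialDeriv (contDiff_potential hW g) j).differentiable (by simp) θ) i
  have h3 (y : X) := hasLineDerivAt_partialDeriv
    ((contDiff_partialDeriv (contDiff_logPF hW g y) j).differentiable (by simp) θ) i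
  exact ((HasDerivAt.const_sub (g j x x') h2).fun_add (h3 x)).fun_sub (h3 x')

/-- The score of a transition has conditional mean zero. -/
theorem sum_expFamily_mul_score (hW : W.IsIrreducible) (g : Fin d → X → X → ℝ) (θ : Fin d → ℝ)
    (i : Fin d) (x' : X) : ∑ x, expFamily W g θ x x' * transitionScore W g θ i x x' = 0 := by
  -- Differentiate the normalization of the columns.
  have h : HasLineDerivAt ℝ (fun θ => ∑ x, expFamily W g θ x x') _ θ (Pi.single i 1) :=
    HasDerivAt.fun_sum (u := Finset.univ) fun x _ => hasLineDerivAt_expFamily hW g θ i x x'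
  simp only [sum_expFamily hW] at h
  exact HasDerivAt.unique h (hasDerivAt_const _ _)

/-- The conditional covariance of the score of a transition is the Hesse matrix of the potential
up to a coboundary. -/
theorem sum_expFamily_mul_score_mul_score (hW : W.IsIrreducible) (g : Fin d → X → X → ℝ)
    (θ : Fin d → ℝ) (i j : Fin d) (x' : X) :
    ∑ x, expFamily W g θ x x' * (transitionScore W g θ i x x' * transitionScore W g θ j x x') =
      hesse (potential W g) θ i j - ∑ x, expFamily W g θ x x' * hesseLogPF W g θ i j x
        + hesseLogPF W g θ i j x' := by
  -- Differentiate the vanishing conditional mean of the `j`-th score in direction `i`.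
  have h : HasLineDerivAt ℝ
      (fun θ => ∑ x, expFamily W g θ x x' * transitionScore W g θ j x x') _ θ (Pi.single i 1) :=
    HasDerivAt.fun_sum (u := Finset.univ) fun x _ =>
      HasDerivAt.fun_mul (hasLineDerivAt_expFamily hW g θ i x x')
        (hasLineDerivAt_transitionScore hW g θ i j x x')
  simp only [sum_expFamily_mul_score hW, zero_smul, add_zero] at h
  have h0 := HasDerivAt.unique h (hasDerivAt_const _ _)
  have e : ∑ x, (expFamily W g θ x x' * transitionScore W g θ i x x' *
        transitionScore W g θ j x x' + expFamily W g θ x x' *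
        (-hesse (potential W g) θ i j + hesseLogPF W g θ i j x - hesseLogPF W g θ i j x')) =
      ∑ x, expFamily W g θ x x' * (transitionScore W g θ i x x' * transitionScore W g θ j x x')
        + ∑ x, expFamily W g θ x x' * hesseLogPF W g θ i j x
        - (∑ x, expFamily W g θ x x') *
          (hesse (potential W g) θ i j + hesseLogPF W g θ i j x') := by
    rw [Finset.sum_mul, ← Finset.sum_add_distrib, ← Finset.sum_sub_distrib]
    exact Finset.sum_congr rfl fun x _ => by ring
  rw [e, sum_expFamily hW] at h0
  linarith

/-- The Hesse matrix of the potential is the stationary covariance of the transition score. -/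
theorem exists_stationary_hesse_eq (hW : W.IsIrreducible) (g : Fin d → X → X → ℝ)
    (θ : Fin d → ℝ) : ∃ π : X → ℝ, (∀ x, 0 < π x) ∧ ∀ i j, hesse (potential W g) θ i j =
      ∑ x', ∑ x, π x' * expFamily W g θ x x' *
        (transitionScore W g θ i x x' * transitionScore W g θ j x x') := by
  set V := expFamily W g θ with hV
  have hVirr : V.IsIrreducible :=
    isIrreducible_of_pos_iff hW (expFamily_nonneg hW g θ) (expFamily_pos_iff hW g θ)
  -- The constant vector is a positive left eigenvector, so the spectral radius is 1 and the right
  -- Perron–Frobenius eigenvector is stationary.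
  have hone : Vᵀ *ᵥ (fun _ => 1) = (1 : ℝ) • fun _ => (1 : ℝ) := by
    ext x'
    simpa [Matrix.mulVec, dotProduct] using sum_expFamily hW g θ x'
  have h1 := eigenvalue_eq_pfEigenvalue hVirr.transpose.nonneg (fun _ => one_pos) hone
  rw [pfEigenvalue_transpose hVirr] at h1
  obtain ⟨hπ, hπ1, hπV⟩ := isPFEigenvector_pfEigenvector hVirr
  rw [← h1, one_smul] at hπV
  refine ⟨pfEigenvector V, hπ, fun i j => ?_⟩
  set π := pfEigenvector V
  have h2 (x : X) : ∑ x', V x x' * π x' = π x := congrFun hπV x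
  simp only [mul_assoc, ← Finset.mul_sum]
  simp only [hV, sum_expFamily_mul_score_mul_score hW, mul_add, mul_sub, Finset.sum_add_distrib,
    Finset.sum_sub_distrib, ← Finset.sum_mul, hπ1]
  simp only [← hV, Finset.mul_sum]
  rw [Finset.sum_comm]
  have h3 : ∑ x, ∑ x', π x' * (V x x' * hesseLogPF W g θ i j x) =
      ∑ x, π x * hesseLogPF W g θ i j x :=
    Finset.sum_congr rfl fun x _ => by
      rw [← h2 x, Finset.sum_mul]
      exact Finset.sum_congr rfl fun x' _ => by ring
  rw [h3]
  ring

omit [DecidableEq X] [Nonempty X] in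
theorem sum_comm_pairs {ι M : Type*} [Fintype ι] [AddCommMonoid M] (F : ι → ι → X → X → M) :
    ∑ i, ∑ j, ∑ x, ∑ y, F i j x y = ∑ x, ∑ y, ∑ i, ∑ j, F i j x y := by
  have h := Finset.sum_comm (s := (Finset.univ : Finset (ι × ι)))
    (t := (Finset.univ : Finset (X × X))) (f := fun p q => F p.1 p.2 q.1 q.2)
  simpa only [Fintype.sum_prod_type] using h

/-- The quadratic form at `c` is the stationary mean square of the score in direction `c`. If it
vanished, that score would be zero on the support of `W`, and `c` would give a forbidden linear
relation between the generators. -/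
theorem hesse_posDef (hW : W.IsIrreducible) {g : Fin d → X → X → ℝ} (hg : IndependentUnder W g)
    (θ : Fin d → ℝ) : (hesse (potential W g) θ).PosDef := by
  obtain ⟨π, hπ, hH⟩ := exists_stationary_hesse_eq hW g θ
  refine Matrix.PosDef.of_dotProduct_mulVec_pos ?_ fun c hc => ?_
  · ext i j
    simp only [Matrix.conjTranspose_apply, star_trivial, hH]
    simp only [mul_comm (transitionScore W g θ i _ _)]
  · have hq : star c ⬝ᵥ hesse (potential W g) θ *ᵥ c = ∑ x', ∑ x, π x' * expFamily W g θ x x' *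
        (∑ i, c i * transitionScore W g θ i x x') ^ 2 := by
      simp only [dotProduct, Matrix.mulVec, hH, star_trivial, Pi.star_apply, Finset.mul_sum,
        Finset.sum_mul, pow_two]
      rw [sum_comm_pairs]
      exact Finset.sum_congr rfl fun x' _ => Finset.sum_congr rfl fun x _ => by
        rw [Finset.sum_comm]
        exact Finset.sum_congr rfl fun i _ => Finset.sum_congr rfl fun j _ => by ring
    rw [hq]
    have hnn (x' x : X) : 0 ≤ π x' * expFamily W g θ x x' *
        (∑ i, c i * transitionScore W g θ i x x') ^ 2 :=
      mul_nonneg (mul_nonneg (hπ x').le (expFamily_nonneg hW g θ x x')) (sq_nonneg _)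
    refine lt_of_le_of_ne (Finset.sum_nonneg fun x' _ => Finset.sum_nonneg fun x _ => hnn x' x)
      fun h0 => ?_
    refine hg c hc ⟨fun x => -∑ i, c i * partialDeriv (logPF W g x) i θ,
      ∑ i, c i * expectationParam W g θ i, fun x x' hx => ?_⟩
    have h1 := (Finset.sum_eq_zero_iff_of_nonneg
      (fun x' _ => Finset.sum_nonneg fun x _ => hnn x' x)).mp h0.symm x' (Finset.mem_univ _)
    have h2 := (Finset.sum_eq_zero_iff_of_nonneg fun x _ => hnn x' x).mp h1 x (Finset.mem_univ _)
    have h3 := (mul_pos (hπ x') ((expFamily_pos_iff hW g θ x x').mpr hx)).ne'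
    have h4 : ∑ i, c i * transitionScore W g θ i x x' = 0 := by simpa [h3] using h2
    simp only [transitionScore, mul_add, mul_sub, Finset.sum_add_distrib,
      Finset.sum_sub_distrib] at h4
    linarith

theorem contDiff_expectationParam (hW : W.IsIrreducible) (g : Fin d → X → X → ℝ) :
    ContDiff ℝ ∞ (expectationParam W g) :=
  contDiff_pi.mpr fun i => contDiff_partialDeriv (contDiff_potential hW g) i

/-- Since `hesse` differentiates in its first index last, the Jacobian acts by row vectors, and no
symmetry of second derivatives is needed. -/
theorem fderiv_expectationParam (hW : W.IsIrreducible) (g : Fin d → X → X → ℝ)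
    (θ v : Fin d → ℝ) :
    fderiv ℝ (expectationParam W g) θ v = v ᵥ* hesse (potential W g) θ := by
  ext j
  have hj := (contDiff_partialDeriv (contDiff_potential hW g) j).differentiable (by simp) θ
  have h := hasFDerivAt_pi'.mp
    ((contDiff_expectationParam hW g).differentiable (by simp) θ).hasFDerivAt j
  have e : fderiv ℝ (partialDeriv (potential W g) j) θ v = fderiv ℝ (expectationParam W g) θ v j :=
    DFunLike.congr_fun (HasFDerivAt.fderiv h) v
  rw [← e, fderiv_apply_eq_sum hj]
  rfl

/-- Along the segment with direction `δ`, the function `η · δ` has derivative the Hesse form at `δ`,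
so it strictly increases. -/
theorem expectationParam_injective (hW : W.IsIrreducible) {g : Fin d → X → X → ℝ}
    (hg : IndependentUnder W g) : Function.Injective (expectationParam W g) := by
  intro θ₁ θ₂ h
  by_contra hne
  set δ := θ₂ - θ₁ with hδ
  have hδ0 : δ ≠ 0 := sub_ne_zero.mpr (Ne.symm hne)
  have hder (t : ℝ) : HasDerivAt (fun t : ℝ => expectationParam W g (θ₁ + t • δ) ⬝ᵥ δ)
      (δ ⬝ᵥ hesse (potential W g) (θ₁ + t • δ) *ᵥ δ) t := by
    have h1 : HasDerivAt (fun t : ℝ => θ₁ + t • δ) δ t := by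
      simpa using ((hasDerivAt_id t).smul_const δ).const_add θ₁
    have h2 := (((contDiff_expectationParam hW g).differentiable (by simp)
      (θ₁ + t • δ)).hasFDerivAt).comp_hasDerivAt t h1
    rw [fderiv_expectationParam hW] at h2
    rw [Matrix.dotProduct_mulVec]
    exact HasDerivAt.fun_sum fun j _ => (hasDerivAt_pi.mp h2 j).mul_const (δ j)
  have hmono := strictMono_of_hasDerivAt_pos hder fun t => by
    simpa using (hesse_posDef hW hg (θ₁ + t • δ)).dotProduct_mulVec_pos hδ0
  have := hmono (zero_lt_one)
  simp [hδ, h] at this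

end ExponentialFamily

/-! ### Expectations on finite sample spaces -/

section Expectation

variable {Ω : Type*} [Fintype Ω] {p : Ω → ℝ}

theorem expect_add (p Y Z : Ω → ℝ) : expect p (fun z => Y z + Z z) = expect p Y + expect p Z := by
  simp only [expect, mul_add, Finset.sum_add_distrib]

theorem expect_const_mul (p : Ω → ℝ) (c : ℝ) (Y : Ω → ℝ) :
    expect p (fun z => c * Y z) = c * expect p Y := by
  simp only [expect, Finset.mul_sum]
  exact Finset.sum_congr rfl fun z _ => by ring

theorem expect_const (hp : p ∈ stdSimplex ℝ Ω) (c : ℝ) : expect p (fun _ => c) = c := by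
  rw [expect, ← Finset.sum_mul, hp.2, one_mul]

theorem abs_expect_le (hp : p ∈ stdSimplex ℝ Ω) {Y : Ω → ℝ} {C : ℝ} (hY : ∀ z, |Y z| ≤ C) :
    |expect p Y| ≤ C := by
  refine (Finset.abs_sum_le_sum_abs _ _).trans ((Finset.sum_le_sum fun z _ => ?_).trans_eq
    (expect_const hp C))
  rw [abs_mul, abs_of_nonneg (hp.1 z)]
  exact mul_le_mul_of_nonneg_left (hY z) (hp.1 z)

/-- Cauchy–Schwarz with one bounded factor. -/
theorem sq_expect_mul_le (hp : p ∈ stdSimplex ℝ Ω) {Y Z : Ω → ℝ} {C : ℝ}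
    (hZ : ∀ z, |Z z| ≤ C) :
    expect p (fun z => Y z * Z z) ^ 2 ≤ C ^ 2 * expect p (fun z => Y z * Y z) := by
  have h := Finset.sum_sq_le_sum_mul_sum_of_sq_le_mul Finset.univ
    (r := fun z => p z * (Y z * Z z)) (f := fun z => p z * (Y z * Y z))
    (g := fun z => p z * (Z z * Z z)) (fun z _ => mul_nonneg (hp.1 z) (mul_self_nonneg _))
    (fun z _ => mul_nonneg (hp.1 z) (mul_self_nonneg _)) (fun z _ => (by ring : _ = _).le)
  have h2 : expect p (fun z => Z z * Z z) ≤ C ^ 2 :=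
    (le_abs_self _).trans (abs_expect_le hp fun z => by
      rw [abs_mul, ← pow_two]
      exact pow_le_pow_left₀ (abs_nonneg _) (hZ z) 2)
  calc expect p (fun z => Y z * Z z) ^ 2 ≤ expect p (fun z => Y z * Y z) *
        expect p (fun z => Z z * Z z) := h
    _ ≤ expect p (fun z => Y z * Y z) * C ^ 2 := mul_le_mul_of_nonneg_left h2
        (Finset.sum_nonneg fun z _ => mul_nonneg (hp.1 z) (mul_self_nonneg _))
    _ = _ := mul_comm _ _

end Expectation

theorem tendsto_inv_mul_of_abs_le {a : ℕ → ℝ} {C : ℝ} (h : ∀ n, |a n| ≤ C) :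
    Tendsto (fun n : ℕ => (n : ℝ)⁻¹ * a n) atTop (𝓝 0) := by
  have hlim : Tendsto (fun n : ℕ => (n : ℝ)⁻¹ * C) atTop (𝓝 0) := by
    simpa using (tendsto_inv_atTop_nhds_zero_nat (𝕜 := ℝ)).mul_const C
  refine squeeze_zero_norm (fun n => ?_) hlim
  rw [Real.norm_eq_abs, abs_mul, abs_of_nonneg (by positivity)]
  exact mul_le_mul_of_nonneg_left (h n) (by positivity)

/-! ### Bounded perturbations of second moments -/

section Perturbation

variable {Ω : ℕ → Type*} [∀ n, Fintype (Ω n)] {p : ∀ n, Ω n → ℝ} {M N B D : ∀ n, Ω n → ℝ}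
  {C a b H : ℝ}

/-- The second moment of `M n` is of order `n`, so by Cauchy–Schwarz the cross moment is of order at
most `√n`. -/
theorem tendsto_inv_mul_expect_mul_bounded (hp : ∀ n, p n ∈ stdSimplex ℝ (Ω n))
    (hM : Tendsto (fun n : ℕ => (n : ℝ)⁻¹ * expect (p n) fun z => M n z * M n z) atTop (𝓝 a))
    (hD : ∀ n z, |D n z| ≤ C) :
    Tendsto (fun n : ℕ => (n : ℝ)⁻¹ * expect (p n) fun z => M n z * D n z) atTop (𝓝 0) := by
  have h1 : Tendsto (fun n : ℕ => √(C ^ 2 * ((n : ℝ)⁻¹ *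
      ((n : ℝ)⁻¹ * expect (p n) fun z => M n z * M n z)))) atTop (𝓝 0) := by
    have := (((tendsto_inv_atTop_nhds_zero_nat (𝕜 := ℝ)).mul hM).const_mul (C ^ 2)).sqrt
    simpa using this
  refine squeeze_zero_norm (fun n => ?_) h1
  refine Real.abs_le_sqrt ?_
  have h2 := mul_le_mul_of_nonneg_left (sq_expect_mul_le (hp n) (Y := M n) (hD n))
    (by positivity : 0 ≤ ((n : ℝ)⁻¹) ^ 2)
  rw [mul_pow]
  exact h2.trans_eq (by ring)

/-- Bounded perturbations do not change second moments at order `n`. -/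
theorem tendsto_inv_mul_expect_perturb (hp : ∀ n, p n ∈ stdSimplex ℝ (Ω n))
    (hM : Tendsto (fun n : ℕ => (n : ℝ)⁻¹ * expect (p n) fun z => M n z * M n z) atTop (𝓝 a))
    (hN : Tendsto (fun n : ℕ => (n : ℝ)⁻¹ * expect (p n) fun z => N n z * N n z) atTop (𝓝 b))
    (hMN : Tendsto (fun n : ℕ => (n : ℝ)⁻¹ * expect (p n) fun z => M n z * N n z) atTop (𝓝 H))
    (hB : ∀ n z, |B n z| ≤ C) (hD : ∀ n z, |D n z| ≤ C) :
    Tendsto (fun n : ℕ => (n : ℝ)⁻¹ * expect (p n) fun z => (M n z + B n z) * (N n z + D n z))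
      atTop (𝓝 H) := by
  have h1 := tendsto_inv_mul_expect_mul_bounded hp hM hD
  have h2 := tendsto_inv_mul_expect_mul_bounded hp hN hB
  have h3 : Tendsto (fun n : ℕ => (n : ℝ)⁻¹ * expect (p n) fun z => B n z * D n z)
      atTop (𝓝 0) :=
    tendsto_inv_mul_of_abs_le (C := C * C) fun n => abs_expect_le (hp n) fun z => by
      rw [abs_mul]
      exact mul_le_mul (hB n z) (hD n z) (abs_nonneg _) ((abs_nonneg _).trans (hB n z))
  have h := ((hMN.add h1).add h2).add h3
  simp only [add_zero] at h
  refine h.congr fun n => ?_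
  rw [← mul_add, ← mul_add, ← mul_add, ← expect_add, ← expect_add, ← expect_add]
  congr 2
  funext z
  ring

end Perturbation

/-! ### Path laws and martingale sums along a Markov chain -/

section PathLaw

variable {X : Type*} [Fintype X] [DecidableEq X] {V : Matrix X X ℝ} {P : X → ℝ}

/-- The sum of `a` over the transitions of a path. -/
def pathSum (a : X → X → ℝ) (n : ℕ) (z : Fin (n + 1) → X) : ℝ :=
  ∑ k : Fin n, a (z k.succ) (z k.castSucc)

omit [Fintype X] [DecidableEq X] in
theorem pathSum_snoc (a : X → X → ℝ) (n : ℕ) (z : Fin (n + 1) → X) (x : X) :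
    pathSum a (n + 1) (Fin.snoc z x : Fin (n + 2) → X) =
      pathSum a n z + a x (z (Fin.last n)) := by
  simp only [pathSum, Fin.sum_univ_castSucc, Fin.succ_last, Fin.snoc_last, Fin.snoc_castSucc,
    ← Fin.castSucc_succ]

omit [Fintype X] [DecidableEq X] in
theorem pathSum_sub (f : X → ℝ) (n : ℕ) (z : Fin (n + 1) → X) :
    pathSum (fun x x' => f x - f x') n z = f (z (Fin.last n)) - f (z 0) := by
  induction n with
  | zero => simp [pathSum]
  | succ n ih =>
    obtain ⟨z, x, rfl⟩ : ∃ (y : Fin (n + 1) → X) (x : X), z = Fin.snoc y x :=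
      ⟨Fin.init z, z (Fin.last _), (Fin.snoc_init_self z).symm⟩
    have h0 : (Fin.snoc z x : Fin (n + 2) → X) 0 = z 0 := Fin.snoc_castSucc (i := 0) ..
    rw [pathSum_snoc, ih, Fin.snoc_last, h0]
    ring

omit [Fintype X] [DecidableEq X] in
theorem pathLaw_snoc (V : Matrix X X ℝ) (P : X → ℝ) (n : ℕ) (z : Fin (n + 1) → X) (x : X) :
    pathLaw V P (n + 1) (Fin.snoc z x : Fin (n + 2) → X) =
      pathLaw V P n z * V x (z (Fin.last n)) := by
  have h0 : (Fin.snoc z x : Fin (n + 2) → X) 0 = z 0 := Fin.snoc_castSucc (i := 0) ..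
  simp only [pathLaw, Fin.prod_univ_castSucc, Fin.succ_last, Fin.snoc_last, Fin.snoc_castSucc,
    ← Fin.castSucc_succ, h0, mul_assoc]

-- This conditions on all but the last observation and drives the inductions on the path length.
omit [DecidableEq X] in
theorem expect_pathLaw_succ (V : Matrix X X ℝ) (P : X → ℝ) (n : ℕ)
    (Y : (Fin (n + 2) → X) → ℝ) :
    expect (pathLaw V P (n + 1)) Y = expect (pathLaw V P n) fun z =>
      ∑ x, V x (z (Fin.last n)) * Y (Fin.snoc z x : Fin (n + 2) → X) := by
  rw [expect, ← (Fin.snocEquiv fun _ => X).sum_comp, Fintype.sum_prod_type, Finset.sum_comm]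
  refine Finset.sum_congr rfl fun z _ => ?_
  rw [Finset.mul_sum]
  refine Finset.sum_congr rfl fun x _ => ?_
  change pathLaw V P (n + 1) (Fin.snoc z x : Fin (n + 2) → X) * _ = _
  rw [pathLaw_snoc, mul_assoc]
  rfl

omit [DecidableEq X] in
theorem pathLaw_mem_stdSimplex (hV : ∀ x x', 0 ≤ V x x') (hV1 : ∀ x', ∑ x, V x x' = 1)
    (hP : P ∈ stdSimplex ℝ X) (n : ℕ) : pathLaw V P n ∈ stdSimplex ℝ (Fin (n + 1) → X) := by
  refine ⟨fun z => mul_nonneg (hP.1 _) (Finset.prod_nonneg fun k _ => hV _ _), ?_⟩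
  have h : expect (pathLaw V P n) (fun _ => 1) = 1 := by
    induction n with
    | zero =>
      rw [expect, ← (Equiv.funUnique (Fin 1) X).symm.sum_comp]
      simpa [pathLaw] using hP.2
    | succ n ih => simpa only [expect_pathLaw_succ, mul_one, hV1] using ih
  simpa [expect] using h

omit [DecidableEq X] in
/-- Sums of martingale differences have mean zero. -/
theorem expect_pathSum {a : X → X → ℝ} (hV1 : ∀ x', ∑ x, V x x' = 1)
    (ha : ∀ x', ∑ x, V x x' * a x x' = 0) (n : ℕ) :
    expect (pathLaw V P n) (pathSum a n) = 0 := by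
  induction n with
  | zero => simp [expect, pathSum]
  | succ n ih =>
    rw [expect_pathLaw_succ, ← ih]
    congr 1
    funext z
    simp only [pathSum_snoc, mul_add, Finset.sum_add_distrib, ← Finset.sum_mul, hV1, ha]
    ring

omit [DecidableEq X] in
/-- The second moments of sums of martingale differences, whose conditional covariance is
constant up to a coboundary. -/
theorem expect_pathSum_mul_pathSum {a b : X → X → ℝ} {h : X → ℝ} {H : ℝ}
    (hV1 : ∀ x', ∑ x, V x x' = 1) (ha : ∀ x', ∑ x, V x x' * a x x' = 0)
    (hb : ∀ x', ∑ x, V x x' * b x x' = 0)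
    (hab : ∀ x', ∑ x, V x x' * (a x x' * b x x') = H - ∑ x, V x x' * h x + h x')
    (hP : P ∈ stdSimplex ℝ X) (hV : ∀ x x', 0 ≤ V x x') (n : ℕ) :
    expect (pathLaw V P n) (fun z => pathSum a n z * pathSum b n z + h (z (Fin.last n))) =
      n * H + expect (pathLaw V P 0) fun z => h (z (Fin.last 0)) := by
  induction n with
  | zero => simp [pathSum]
  | succ n ih =>
    -- Given the past, the cross terms vanish by `ha` and `hb`; adding `h` of the last state absorbs
    -- the coboundary, so each step contributes exactly `H`.
    have e (z : Fin (n + 1) → X) : ∑ x, V x (z (Fin.last n)) *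
        (pathSum a (n + 1) (Fin.snoc z x : Fin (n + 2) → X) *
          pathSum b (n + 1) (Fin.snoc z x : Fin (n + 2) → X) +
          h ((Fin.snoc z x : Fin (n + 2) → X) (Fin.last (n + 1)))) =
        (pathSum a n z * pathSum b n z + h (z (Fin.last n))) + H := by
      set x' := z (Fin.last n) with hx'
      have e2 : ∑ x, V x x' * ((pathSum a n z + a x x') * (pathSum b n z + b x x') + h x) =
          (∑ x, V x x') * (pathSum a n z * pathSum b n z) +
          (∑ x, V x x' * b x x') * pathSum a n z + (∑ x, V x x' * a x x') * pathSum b n z +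
          ∑ x, V x x' * (a x x' * b x x') + ∑ x, V x x' * h x := by
        simp only [Finset.sum_mul, ← Finset.sum_add_distrib]
        exact Finset.sum_congr rfl fun x _ => by ring
      simp only [pathSum_snoc, Fin.snoc_last, ← hx', e2, hV1, ha, hb, hab]
      ring
    rw [expect_pathLaw_succ]
    simp only [e]
    rw [expect_add, ih, expect_const (pathLaw_mem_stdSimplex hV hV1 hP n)]
    push_cast
    ring

-- The correction by `h` is bounded uniformly in `n`, so division by `n` removes both it and the
-- dependence on `P`.
omit [DecidableEq X] in
theorem tendsto_inv_mul_expect_pathSum_mul_pathSum {a b : X → X → ℝ} {h : X → ℝ} {H : ℝ}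
    (hV1 : ∀ x', ∑ x, V x x' = 1) (ha : ∀ x', ∑ x, V x x' * a x x' = 0)
    (hb : ∀ x', ∑ x, V x x' * b x x' = 0)
    (hab : ∀ x', ∑ x, V x x' * (a x x' * b x x') = H - ∑ x, V x x' * h x + h x')
    (hP : P ∈ stdSimplex ℝ X) (hV : ∀ x x', 0 ≤ V x x') :
    Tendsto (fun n : ℕ => (n : ℝ)⁻¹ *
      expect (pathLaw V P n) fun z => pathSum a n z * pathSum b n z) atTop (𝓝 H) := by
  have hh (x : X) : |h x| ≤ ∑ y, |h y| :=
    Finset.single_le_sum (f := fun y => |h y|) (fun y _ => abs_nonneg _) (Finset.mem_univ x)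
  have hb1 (n : ℕ) := abs_expect_le (pathLaw_mem_stdSimplex hV hV1 hP n)
    (Y := fun z => h (z (Fin.last n))) fun z => hh _
  have h0 := tendsto_inv_mul_of_abs_le fun n => (abs_sub _ _).trans
    (add_le_add (hb1 0) (hb1 n))
  have h1 := h0.const_add H
  rw [add_zero] at h1
  refine h1.congr' ?_
  filter_upwards [eventually_gt_atTop 0] with n hn
  have e := expect_pathSum_mul_pathSum hV1 ha hb hab hP hV n
  rw [expect_add] at e
  have hn' : (n : ℝ) ≠ 0 := by positivity
  field_simp
  linarith

end PathLaw

/-! ### Fisher information under a change of parameters -/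

section Reparametrization

variable {d : ℕ} {Ω : Type*} [Fintype Ω]

/-- The transformation rule of the Fisher information under an injective change of parameters
whose Jacobian matrix at `θ` is the transpose of `H`. -/
theorem fisherInfoReparam_eq {p : (Fin d → ℝ) → Ω → ℝ} {η : (Fin d → ℝ) → Fin d → ℝ}
    {θ : Fin d → ℝ} {H : Matrix (Fin d) (Fin d) ℝ} (hη : Function.Injective η)
    (hsmooth : ContDiff ℝ ∞ η) (hder : ∀ v, fderiv ℝ η θ v = v ᵥ* H) (hH : IsUnit H.det)
    (hp : ∀ z, p θ z ≠ 0 → DifferentiableAt ℝ (fun θ' => p θ' z) θ) :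
    fisherInfoReparam p η θ = H⁻¹ * fisherInfo p θ * (H⁻¹)ᵀ := by
  have hstrict : HasStrictFDerivAt η (fderiv ℝ η θ) θ :=
    hsmooth.contDiffAt.hasStrictFDerivAt (by simp)
  let L : (Fin d → ℝ) ≃L[ℝ] (Fin d → ℝ) := LinearEquiv.toContinuousLinearEquiv
    { (fderiv ℝ η θ : (Fin d → ℝ) →ₗ[ℝ] (Fin d → ℝ)) with
      invFun := fun w => w ᵥ* H⁻¹
      left_inv := fun v => by
        change (fderiv ℝ η θ v) ᵥ* H⁻¹ = v
        rw [hder, Matrix.vecMul_vecMul, Matrix.mul_nonsing_inv _ hH, Matrix.vecMul_one]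
      right_inv := fun w => by
        change fderiv ℝ η θ (w ᵥ* H⁻¹) = w
        rw [hder, Matrix.vecMul_vecMul, Matrix.nonsing_inv_mul _ hH, Matrix.vecMul_one] }
  have hL : (L : (Fin d → ℝ) →L[ℝ] (Fin d → ℝ)) = fderiv ℝ η θ := rfl
  rw [← hL] at hstrict
  -- Injectivity makes `Function.invFun η` a left inverse everywhere, so the inverse function
  -- theorem computes its derivative at `η θ`.
  have hleft : ∀ θ', Function.invFun η (η θ') = θ' := Function.leftInverse_invFun hη
  have hinv := (hstrict.to_local_left_inverse (Eventually.of_forall hleft)).hasFDerivAt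
  have hscore (z : Ω) (hz : p θ z ≠ 0) (i : Fin d) :
      partialDeriv (fun e => Real.log (p (Function.invFun η e) z)) i (η θ) =
        ∑ k, H⁻¹ i k * partialDeriv (fun θ' => Real.log (p θ' z)) k θ := by
    have hlog : DifferentiableAt ℝ (fun θ' => Real.log (p θ' z)) θ := (hp z hz).log hz
    have h1 : HasFDerivAt (fun θ' => Real.log (p θ' z))
      (fderiv ℝ (fun θ' => Real.log (p θ' z)) θ) (Function.invFun η (η θ)) := by
      rw [hleft]; exact hlog.hasFDerivAt
    have h2 := h1.comp (η θ) hinv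
    have h3 : partialDeriv (fun e => Real.log (p (Function.invFun η e) z)) i (η θ) =
        fderiv ℝ (fun θ' => Real.log (p θ' z)) θ (Pi.single i 1 ᵥ* H⁻¹) :=
      (h2.hasLineDerivAt (Pi.single i 1)).lineDeriv
    rw [h3, fderiv_apply_eq_sum hlog]
    simp
  ext i j
  have hterm (z : Ω) : p θ z *
      (partialDeriv (fun e => Real.log (p (Function.invFun η e) z)) i (η θ) *
        partialDeriv (fun e => Real.log (p (Function.invFun η e) z)) j (η θ)) =
      ∑ k, ∑ l, H⁻¹ i l * (p θ z * (partialDeriv (fun θ' => Real.log (p θ' z)) l θ *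
        partialDeriv (fun θ' => Real.log (p θ' z)) k θ)) * H⁻¹ j k := by
    by_cases hz : p θ z = 0
    · simp [hz]
    -- The chain rule for the logarithm is available only at points of non-zero mass; the others
    -- carry weight zero.
    · rw [hscore z hz i, hscore z hz j, Finset.sum_mul_sum, Finset.sum_comm, Finset.mul_sum]
      refine Finset.sum_congr rfl fun k _ => ?_
      rw [Finset.mul_sum]
      exact Finset.sum_congr rfl fun l _ => by ring
  simp only [fisherInfoReparam, fisherInfo, Matrix.of_apply, expect, hleft, hterm,
    Matrix.mul_apply, Matrix.transpose_apply, Finset.mul_sum, Finset.sum_mul]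
  rw [Finset.sum_comm]
  exact Finset.sum_congr rfl fun k _ => Finset.sum_comm

end Reparametrization

theorem tendsto_matrix {ι m n R : Type*} [TopologicalSpace R] {l : Filter ι}
    {F : ι → Matrix m n R} {G : Matrix m n R}
    (h : ∀ i j, Tendsto (fun k => F k i j) l (𝓝 (G i j))) : Tendsto F l (𝓝 G) :=
  tendsto_pi_nhds.mpr fun i => tendsto_pi_nhds.mpr fun j => h i j

theorem tendsto_matrix_inv {ι n : Type*} [Fintype n] [DecidableEq n] {l : Filter ι}
    {F : ι → Matrix n n ℝ} {G : Matrix n n ℝ} (h : Tendsto F l (𝓝 G)) (hG : G.det ≠ 0) :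
    Tendsto (fun k => (F k)⁻¹) l (𝓝 G⁻¹) := by
  simp only [Matrix.inv_def, Ring.inverse_eq_inv']
  exact ((((continuous_id.matrix_det).tendsto G).comp h).inv₀ hG).smul
    (((continuous_id.matrix_adjugate).tendsto G).comp h)

/-! ### Limits for the Markov chain and asymptotic efficiency -/

section Chain

variable {X : Type*} [Fintype X] [DecidableEq X] [Nonempty X] {d : ℕ} {W : Matrix X X ℝ}
  {g : Fin d → X → X → ℝ} {P : (Fin d → ℝ) → X → ℝ}

theorem chainFamily_mem_stdSimplex (hW : W.IsIrreducible) (hP : ∀ θ, P θ ∈ stdSimplex ℝ X)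
    (n : ℕ) (θ : Fin d → ℝ) : chainFamily W g P n θ ∈ stdSimplex ℝ (Fin (n + 1) → X) :=
  pathLaw_mem_stdSimplex (expFamily_nonneg hW g θ) (sum_expFamily hW g θ) (hP θ) n

/-- Second moments of bounded perturbations of the sum of the transition scores. -/
theorem tendsto_inv_mul_expect_scoreSum (hW : W.IsIrreducible) (hP : ∀ θ, P θ ∈ stdSimplex ℝ X)
    (θ : Fin d → ℝ) (i j : Fin d) {B : ∀ n, Fin d → (Fin (n + 1) → X) → ℝ} {C : ℝ}
    (hB : ∀ n i z, |B n i z| ≤ C) :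
    Tendsto (fun n : ℕ => (n : ℝ)⁻¹ * expect (chainFamily W g P n θ) fun z =>
      (pathSum (transitionScore W g θ i) n z + B n i z) *
        (pathSum (transitionScore W g θ j) n z + B n j z))
      atTop (𝓝 (hesse (potential W g) θ i j)) := by
  have h (i j : Fin d) := tendsto_inv_mul_expect_pathSum_mul_pathSum (P := P θ)
    (sum_expFamily hW g θ) (sum_expFamily_mul_score hW g θ i) (sum_expFamily_mul_score hW g θ j)
    (sum_expFamily_mul_score_mul_score hW g θ i j) (hP θ) (expFamily_nonneg hW g θ)
  exact tendsto_inv_mul_expect_perturb (fun n => chainFamily_mem_stdSimplex hW hP n θ)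
    (h i i) (h j j) (h i j) (fun n => hB n i) (fun n => hB n j)

omit [DecidableEq X] [Nonempty X] in
theorem abs_le_sum_sum (f : Fin d → X → ℝ) (i : Fin d) (x : X) :
    |f i x| ≤ ∑ i, ∑ x, |f i x| :=
  (Finset.single_le_sum (f := fun x => |f i x|) (fun _ _ => abs_nonneg _)
    (Finset.mem_univ x)).trans
  (Finset.single_le_sum (f := fun i => ∑ x, |f i x|)
    (fun _ _ => Finset.sum_nonneg fun _ _ => abs_nonneg _) (Finset.mem_univ i))

/-- The boundary term in the difference of the sample sum of the generator and the sum of the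
transition scores. -/
def boundaryTerm (W : Matrix X X ℝ) (g : Fin d → X → X → ℝ) (θ : Fin d → ℝ) (n : ℕ) (i : Fin d)
    (z : Fin (n + 1) → X) : ℝ :=
  partialDeriv (logPF W g (z 0)) i θ - partialDeriv (logPF W g (z (Fin.last n))) i θ

omit [Nonempty X] in
theorem abs_boundaryTerm_le (W : Matrix X X ℝ) (g : Fin d → X → X → ℝ) (θ : Fin d → ℝ) (n : ℕ)
    (i : Fin d) (z : Fin (n + 1) → X) : |boundaryTerm W g θ n i z| ≤
      2 * ∑ i, ∑ x, |partialDeriv (logPF W g x) i θ| := by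
  have h := abs_le_sum_sum fun i x => partialDeriv (logPF W g x) i θ
  have := (abs_sub (partialDeriv (logPF W g (z 0)) i θ)
    (partialDeriv (logPF W g (z (Fin.last n))) i θ)).trans
      (add_le_add (h i (z 0)) (h i (z (Fin.last n))))
  rw [boundaryTerm]
  linarith

-- The coboundary part of the transition scores telescopes along the path, which leaves only the two
-- end points.
omit [Nonempty X] in
theorem sampleMean_sub_expectationParam (W : Matrix X X ℝ) (g : Fin d → X → X → ℝ)
    (θ : Fin d → ℝ) {n : ℕ} (hn : n ≠ 0) (i : Fin d) (z : Fin (n + 1) → X) :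
    sampleMean g n z i - expectationParam W g θ i =
      (n : ℝ)⁻¹ * (pathSum (transitionScore W g θ i) n z + boundaryTerm W g θ n i z) := by
  have h := pathSum_sub (fun x => partialDeriv (logPF W g x) i θ) n z
  have e : pathSum (transitionScore W g θ i) n z = ∑ k : Fin n, g i (z k.succ) (z k.castSucc)
      - n * expectationParam W g θ i +
      pathSum (fun x x' => partialDeriv (logPF W g x) i θ - partialDeriv (logPF W g x') i θ) n z := by
    simp only [pathSum, transitionScore, add_sub_assoc, Finset.sum_add_distrib,
      Finset.sum_sub_distrib, Finset.sum_const, Finset.card_univ, Fintype.card_fin, nsmul_eq_mul]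
  have hn' : (n : ℝ) ≠ 0 := by positivity
  rw [e, h, boundaryTerm, sampleMean]
  field_simp
  ring

theorem expect_sampleMean (hW : W.IsIrreducible) (hP : ∀ θ, P θ ∈ stdSimplex ℝ X)
    (θ : Fin d → ℝ) {n : ℕ} (hn : n ≠ 0) (i : Fin d) :
    expect (chainFamily W g P n θ) (fun z => sampleMean g n z i) = expectationParam W g θ i +
      (n : ℝ)⁻¹ * expect (chainFamily W g P n θ) (boundaryTerm W g θ n i) := by
  have e : (fun z => sampleMean g n z i) = fun z => expectationParam W g θ i + (n : ℝ)⁻¹ *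
      (pathSum (transitionScore W g θ i) n z + boundaryTerm W g θ n i z) :=
    funext fun z => by rw [← sampleMean_sub_expectationParam W g θ hn]; ring
  have h0 : expect (chainFamily W g P n θ) (pathSum (transitionScore W g θ i) n) = 0 :=
    expect_pathSum (sum_expFamily hW g θ) (sum_expFamily_mul_score hW g θ i) n
  rw [e, expect_add, expect_const (chainFamily_mem_stdSimplex hW hP n θ), expect_const_mul,
    expect_add, h0, zero_add]

theorem tendsto_expect_sampleMean (hW : W.IsIrreducible) (hP : ∀ θ, P θ ∈ stdSimplex ℝ X)
    (θ : Fin d → ℝ) (i : Fin d) :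
    Tendsto (fun n => expect (chainFamily W g P n θ) fun z => sampleMean g n z i) atTop
      (𝓝 (expectationParam W g θ i)) := by
  have h := (tendsto_inv_mul_of_abs_le fun n => abs_expect_le
    (chainFamily_mem_stdSimplex (g := g) hW hP n θ) (abs_boundaryTerm_le W g θ n i)).const_add
      (expectationParam W g θ i)
  rw [add_zero] at h
  refine h.congr' ?_
  filter_upwards [eventually_ne_atTop 0] with n hn using (expect_sampleMean hW hP θ hn i).symm

theorem tendsto_mseMatrix (hW : W.IsIrreducible) (hP : ∀ θ, P θ ∈ stdSimplex ℝ X)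
    (θ : Fin d → ℝ) : Tendsto (fun n : ℕ => (n : ℝ) • mseMatrix (chainFamily W g P n θ)
      (sampleMean g n) (expectationParam W g θ)) atTop (𝓝 (hesse (potential W g) θ)) := by
  refine tendsto_matrix fun i j => ?_
  refine (tendsto_inv_mul_expect_scoreSum hW hP θ i j (abs_boundaryTerm_le W g θ)).congr' ?_
  filter_upwards [eventually_ne_atTop 0] with n hn
  simp only [Matrix.smul_apply, mseMatrix, Matrix.of_apply, smul_eq_mul,
    sampleMean_sub_expectationParam W g θ hn]
  rw [← expect_const_mul, ← expect_const_mul]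
  congr 1
  funext z
  have hn' : (n : ℝ) ≠ 0 := by positivity
  field_simp

theorem tendsto_covMatrix (hW : W.IsIrreducible) (hP : ∀ θ, P θ ∈ stdSimplex ℝ X)
    (θ : Fin d → ℝ) : Tendsto (fun n : ℕ => (n : ℝ) • covMatrix (chainFamily W g P n θ)
      (sampleMean g n)) atTop (𝓝 (hesse (potential W g) θ)) := by
  refine tendsto_matrix fun i j => ?_
  -- Centring at the true mean instead of `η` only recentres the boundary term, which stays bounded
  -- uniformly in `n`.
  have hB (n : ℕ) (i : Fin d) (z : Fin (n + 1) → X) : |boundaryTerm W g θ n i z -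
      expect (chainFamily W g P n θ) (boundaryTerm W g θ n i)| ≤ _ :=
    (abs_sub _ _).trans (add_le_add (abs_boundaryTerm_le W g θ n i z)
      (abs_expect_le (chainFamily_mem_stdSimplex hW hP n θ) (abs_boundaryTerm_le W g θ n i)))
  refine (tendsto_inv_mul_expect_scoreSum hW hP θ i j hB).congr' ?_
  filter_upwards [eventually_ne_atTop 0] with n hn
  have e (i : Fin d) (z : Fin (n + 1) → X) : sampleMean g n z i -
      expect (chainFamily W g P n θ) (fun z => sampleMean g n z i) = (n : ℝ)⁻¹ *
      (pathSum (transitionScore W g θ i) n z + (boundaryTerm W g θ n i z -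
      expect (chainFamily W g P n θ) (boundaryTerm W g θ n i))) := by
    have := sampleMean_sub_expectationParam W g θ hn i z
    rw [expect_sampleMean hW hP θ hn i]
    linarith
  simp only [Matrix.smul_apply, covMatrix, Matrix.of_apply, smul_eq_mul, e]
  rw [← expect_const_mul, ← expect_const_mul]
  congr 1
  funext z
  have hn' : (n : ℝ) ≠ 0 := by positivity
  field_simp

theorem chainFamily_apply (hW : W.IsIrreducible) (n : ℕ) (z : Fin (n + 1) → X)
    (θ : Fin d → ℝ) : chainFamily W g P n θ z =
      P θ (z 0) * ((∏ k : Fin n, W (z k.succ) (z k.castSucc)) *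
        Real.exp (pathSum (fun x x' => ∑ j, θ j * g j x x' - potential W g θ + logPF W g x θ
          - logPF W g x' θ) n z)) := by
  simp only [chainFamily, pathLaw, expFamily_apply hW, Finset.prod_mul_distrib, pathSum,
    Real.exp_sum]

theorem differentiable_chainFamily (hW : W.IsIrreducible)
    (hP : ∀ x, ContDiff ℝ ∞ fun θ => P θ x) (n : ℕ) (z : Fin (n + 1) → X) :
    Differentiable ℝ fun θ => chainFamily W g P n θ z := by
  simp only [chainFamily_apply hW, pathSum]
  have h1 := (contDiff_potential hW g).differentiable (by simp)
  have h2 (x : X) := (contDiff_logPF hW g x).differentiable (by simp)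
  have h3 (x : X) := (hP x).differentiable (by simp)
  fun_prop

/-- The score of the chain family is the sum of the transition scores and the score of the initial
distribution. -/
theorem partialDeriv_log_chainFamily (hW : W.IsIrreducible)
    (hP : ∀ x, ContDiff ℝ ∞ fun θ => P θ x) {n : ℕ} {z : Fin (n + 1) → X} {θ : Fin d → ℝ}
    (hz : chainFamily W g P n θ z ≠ 0) (i : Fin d) :
    partialDeriv (fun θ => Real.log (chainFamily W g P n θ z)) i θ =
      pathSum (transitionScore W g θ i) n z +
        partialDeriv (fun θ => P θ (z 0)) i θ / P θ (z 0) := by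
  have h1 := hasLineDerivAt_partialDeriv ((hP (z 0)).differentiable (by simp) θ) i
  have h2 : HasLineDerivAt ℝ (fun θ => pathSum (fun x x' => ∑ j, θ j * g j x x' -
      potential W g θ + logPF W g x θ - logPF W g x' θ) n z)
      (pathSum (transitionScore W g θ i) n z) θ (Pi.single i 1) :=
    HasDerivAt.fun_sum fun k _ => hasLineDerivAt_logDensity hW g θ i _ _
  have h3 := (HasDerivAt.fun_mul h1 ((HasDerivAt.exp h2).const_mul
    (∏ k : Fin n, W (z k.succ) (z k.castSucc)))).congr_of_eventuallyEq
    (Eventually.of_forall fun t => chainFamily_apply (P := P) hW n z _)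
  have h4 := HasDerivAt.log h3 (by simpa using hz)
  have h5 : partialDeriv (fun θ => Real.log (chainFamily W g P n θ z)) i θ = _ := h4.deriv
  rw [h5]
  simp only [zero_smul, add_zero]
  rw [chainFamily_apply hW] at hz ⊢
  have hz1 := left_ne_zero_of_mul hz
  have hz2 := left_ne_zero_of_mul (right_ne_zero_of_mul hz)
  field_simp
  ring

theorem tendsto_fisherInfo (hW : W.IsIrreducible) (hP : ∀ θ, P θ ∈ stdSimplex ℝ X)
    (hPs : ∀ x, ContDiff ℝ ∞ fun θ => P θ x) (θ : Fin d → ℝ) :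
    Tendsto (fun n : ℕ => (n : ℝ)⁻¹ • fisherInfo (chainFamily W g P n) θ) atTop
      (𝓝 (hesse (potential W g) θ)) := by
  refine tendsto_matrix fun i j => ?_
  -- The perturbation is the score of the initial distribution. It depends on the first state only,
  -- so finiteness of `X` bounds it uniformly in `n`; the quotient is `0` by convention where `P θ`
  -- vanishes.
  refine (tendsto_inv_mul_expect_scoreSum hW hP θ i j
    (B := fun n i z => partialDeriv (fun θ => P θ (z 0)) i θ / P θ (z 0)) fun n i z =>
      abs_le_sum_sum (fun i x => partialDeriv (fun θ => P θ x) i θ / P θ x) i (z 0)).congr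
    fun n => ?_
  simp only [Matrix.smul_apply, fisherInfo, Matrix.of_apply, smul_eq_mul, expect]
  congr 1
  refine Finset.sum_congr rfl fun z _ => ?_
  by_cases hz : chainFamily W g P n θ z = 0
  · simp [hz]
  · rw [partialDeriv_log_chainFamily hW hPs hz, partialDeriv_log_chainFamily hW hPs hz]

/-- By the transformation rule the limit is `H⁻¹ * H * (H⁻¹)ᵀ`, and `H` is symmetric. -/
theorem tendsto_fisherInfoReparam (hW : W.IsIrreducible) (hg : IndependentUnder W g)
    (hP : ∀ θ, P θ ∈ stdSimplex ℝ X) (hPs : ∀ x, ContDiff ℝ ∞ fun θ => P θ x) (θ : Fin d → ℝ) :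
    Tendsto (fun n : ℕ => (n : ℝ)⁻¹ • fisherInfoReparam (chainFamily W g P n)
      (expectationParam W g) θ) atTop (𝓝 (hesse (potential W g) θ)⁻¹) := by
  have hpd := hesse_posDef hW hg θ
  have hdet : IsUnit (hesse (potential W g) θ).det := hpd.det_pos.ne'.isUnit
  have hsymm : ((hesse (potential W g) θ)⁻¹)ᵀ = (hesse (potential W g) θ)⁻¹ := by
    rw [Matrix.transpose_nonsing_inv]
    congr 1
    simpa using hpd.isHermitian.eq
  have h := ((tendsto_const_nhds (x := (hesse (potential W g) θ)⁻¹)).mul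
    (tendsto_fisherInfo (g := g) hW hP hPs θ)).mul
    (tendsto_const_nhds (x := ((hesse (potential W g) θ)⁻¹)ᵀ))
  rw [Matrix.nonsing_inv_mul _ hdet, one_mul, hsymm] at h
  refine h.congr fun n => ?_
  rw [fisherInfoReparam_eq (expectationParam_injective hW hg) (contDiff_expectationParam hW g)
    (fderiv_expectationParam hW g θ) hdet fun z _ => differentiable_chainFamily hW hPs n z θ]
  rw [hsymm]
  simp

/-- The rescaled information converges to a matrix with non-zero determinant. -/
theorem eventually_isUnit_det_fisherInfoReparam (hW : W.IsIrreducible)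
    (hg : IndependentUnder W g) (hP : ∀ θ, P θ ∈ stdSimplex ℝ X)
    (hPs : ∀ x, ContDiff ℝ ∞ fun θ => P θ x) (θ : Fin d → ℝ) :
    ∀ᶠ n in atTop,
      IsUnit (fisherInfoReparam (chainFamily W g P n) (expectationParam W g) θ).det := by
  have hpd := hesse_posDef hW hg θ
  have h := ((continuous_id.matrix_det).tendsto _).comp (tendsto_fisherInfoReparam hW hg hP hPs θ)
  have h2 := h.eventually_ne hpd.inv.det_pos.ne'
  filter_upwards [h2] with n hn
  refine isUnit_iff_ne_zero.mpr fun h0 => hn ?_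
  simp [h0]

theorem isAsymptoticallyEfficient_sampleMean (hW : W.IsIrreducible)
    (hg : IndependentUnder W g) (hP : ∀ θ, P θ ∈ stdSimplex ℝ X)
    (hPs : ∀ x, ContDiff ℝ ∞ fun θ => P θ x) :
    IsAsymptoticallyEfficient (chainFamily W g P) (sampleMean g) (expectationParam W g) where
  unbiased := tendsto_expect_sampleMean hW hP
  regular := eventually_isUnit_det_fisherInfoReparam hW hg hP hPs
  attains θ := by
    have hpd := hesse_posDef hW hg θ
    have h := (tendsto_mseMatrix (g := g) hW hP θ).sub
      (tendsto_matrix_inv (tendsto_fisherInfoReparam hW hg hP hPs θ) hpd.inv.det_pos.ne')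
    rw [Matrix.nonsing_inv_nonsing_inv _ hpd.det_pos.ne'.isUnit, sub_self] at h
    refine h.congr' ?_
    filter_upwards [eventually_ne_atTop 0,
      eventually_isUnit_det_fisherInfoReparam hW hg hP hPs θ] with n hn hu
    have hn' : (n : ℝ)⁻¹ ≠ 0 := by positivity
    -- Inverting the information divided by `n` yields `n` times its inverse, which has the same
    -- limit as `n` times the mean square error.
    have e := Matrix.inv_smul' _ (Units.mk0 _ hn') hu
    simp only [Units.smul_def, Units.val_mk0, Units.val_inv_eq_inv_val, inv_inv] at e
    rw [e, smul_sub]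

end Chain

end MarkovExp

end

theorem mainTheorem9 {X : Type*} [Fintype X] [DecidableEq X] {d : ℕ}
    (W : Matrix X X ℝ) (hW : W ∈ Matrix.colStochastic ℝ X) (hErg : MarkovExp.IsErgodic W)
    (g : Fin d → X → X → ℝ) (hg : MarkovExp.IndependentUnder W g)
    (P : (Fin d → ℝ) → X → ℝ) (hP : ∀ θ, P θ ∈ stdSimplex ℝ X)
    (hPsmooth : ∀ x, ContDiff ℝ ∞ fun θ => P θ x) :
    -- the quantities below are well defined
    (ContDiff ℝ 2 (MarkovExp.potential W g) ∧
      Function.Injective (MarkovExp.expectationParam W g) ∧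
      ∀ θ, (MarkovExp.hesse (MarkovExp.potential W g) θ).PosDef) ∧
    -- mean square error matrix and covariance matrix of the sample mean
    (∀ θ, Tendsto
      (fun n : ℕ => (n : ℝ) • MarkovExp.mseMatrix (MarkovExp.chainFamily W g P n θ)
        (MarkovExp.sampleMean g n) (MarkovExp.expectationParam W g θ))
      atTop (𝓝 (MarkovExp.hesse (MarkovExp.potential W g) θ))) ∧
    (∀ θ, Tendsto
      (fun n : ℕ => (n : ℝ) • MarkovExp.covMatrix (MarkovExp.chainFamily W g P n θ)
        (MarkovExp.sampleMean g n))
      atTop (𝓝 (MarkovExp.hesse (MarkovExp.potential W g) θ))) ∧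
    -- Fisher information matrices for the natural and for the expectation parameter
    (∀ θ, Tendsto
      (fun n : ℕ => (n : ℝ)⁻¹ • MarkovExp.fisherInfo (MarkovExp.chainFamily W g P n) θ)
      atTop (𝓝 (MarkovExp.hesse (MarkovExp.potential W g) θ))) ∧
    (∀ θ, Tendsto
      (fun n : ℕ => (n : ℝ)⁻¹ • MarkovExp.fisherInfoReparam (MarkovExp.chainFamily W g P n)
        (MarkovExp.expectationParam W g) θ)
      atTop (𝓝 (MarkovExp.hesse (MarkovExp.potential W g) θ)⁻¹)) ∧
    -- asymptotic efficiency
    MarkovExp.IsAsymptoticallyEfficient (MarkovExp.chainFamily W g P)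
      (MarkovExp.sampleMean g) (MarkovExp.expectationParam W g) := by
  have hirr := hErg.1
  -- An empty state space carries no probability vector.
  have : Nonempty X := by
    by_contra hX
    rw [not_nonempty_iff] at hX
    simpa using (hP 0).2
  exact ⟨⟨contDiff_infty.mp (MarkovExp.contDiff_potential hirr g) 2,
    MarkovExp.expectationParam_injective hirr hg, MarkovExp.hesse_posDef hirr hg⟩,
    MarkovExp.tendsto_mseMatrix hirr hP, MarkovExp.tendsto_covMatrix hirr hP,
    MarkovExp.tendsto_fisherInfo hirr hP hPsmooth,
    MarkovExp.tendsto_fisherInfoReparam hirr hg hP hPsmooth,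
    MarkovExp.isAsymptoticallyEfficient_sampleMean hirr hg hP hPsmooth⟩
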